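/- Let ${\cal L}$ be a complemented modular lattice of finite rank $n$, with least element $\mathbf 0$ and greatest element $\mathbf 1$. Let $K({\cal L})$ be its orthoscheme complex: the set of formal convex combinations $x=\sum_p \lambda(p)\,p$ of elements of ${\cal L}$ whose support is a chain. The simplex of a maximal chain $p_0\prec p_1\prec\cdots\prec p_n$ is mapped to ${\bf R}^n$ by $\sum_i\lambda_i p_i\mapsto\sum_{i=1}^n\lambda_i(e_1+\cdots+e_i)$. Let $d$ (resp. $d_1$) be the length metric on $K({\cal L})$ obtained by using the Euclidean norm (resp. the $l_1$-norm) on every maximal simplex through this map: the infimum of the lengths of finite sequences of points from $x$ to $y$ in which consecutive points lie in a common maximal simplex. Let $C\ge 0$, $\epsilon\ge 0$, $\lambda>0$ and $f(y):=-C\,d_1(\mathbf 0,y)+\epsilon\, d(\mathbf 0,y)^2$. **Theorem.** For every $x\in K({\cal L})$ the function $y\mapsto f(y)+\frac1{2\lambda}d(x,y)^2$ has a unique minimizer $J(x)$ on $K({\cal L})$; thus $J$ is the resolvent of $f$. Moreover: 1. Every maximal simplex of $K({\cal L})$ that contains $x$ also contains $J(x)$, and every maximal chain of ${\cal L}$ is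 contained in some frame, where the frame of a base (atoms $a_1,\dots,a_n$ with $a_1\vee\cdots\vee a_n=\mathbf 1$) is the set of all joins $\bigvee_{i\in S}a_i$, $S\subseteq\{1,\dots,n\}$. 2. For every frame ${\cal F}$ that contains the support of $x$, it also contains the support of $J(x)$, and in ${\cal F}$-coordinates (the image in $[0,1]^n$ under the linear map $\bigvee_{i\in S}a_i\mapsto 1_S$) $$J(x)_i=\max\Bigl\{0,\min\Bigl\{1,\frac{x_i+\lambda C}{1+2\epsilon\lambda}\Bigr\}\Bigr\}\qquad(i=1,\dots,n).$$ 3. $J(x)$ is computed in polynomial time: there are one program of a random access machine and two polynomials, independent of ${\cal L},n,C,\epsilon,\lambda,x$, with the following property. The machine has index registers, a memory for numbers with the operations $+,-,\times,/$ and comparison, and a memory for elements of ${\cal L}$, which are black boxes: they can be copied and compared in the order, and $\mathbf 0,\mathbf 1$ are available. On input $C,\epsilon,\lambda$ and any expression $x=\sum_{i=1}^k c_i p_i$ over a chain $p_1\prec\cdots\prec p_k$ (zero coefficients allowed), the program halts after a number of steps bounded by the first polynomial in $k$ and outputs an expression of $J(x)$ of the same kind. If $C,\epsilon,\lambda,c_1,\dots,c_k$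 are rational, then all numbers in the memory are rational at all times, and their bit lengths are bounded by the second polynomial in the total bit length of $C,\epsilon,\lambda,c_1,\dots,c_k$. -/

import Mathlib

universe u

noncomputable section

namespace Ortho

/-! ### The orthoscheme complex -/

section Complex

variable (L : Type u) [Lattice L] [BoundedOrder L]

/-- The underlying set of the orthoscheme complex: formal convex combinations of lattice elements
whose support is a chain. -/
def K : Type u :=
  {x : L →₀ ℝ // (∀ p, 0 ≤ x p) ∧ (x.sum fun _ c => c) = 1 ∧
    IsChain (· ≤ ·) (x.support : Set L)}

variable {L}

/-- The coefficient of `p` in the point `x`. -/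
def K.coeff (x : K L) (p : L) : ℝ := x.1 p

/-- The support of the point `x`. -/
def K.supp (x : K L) : Set L := (x.1.support : Set L)

/-- The lattice element `p`, viewed as a vertex of the complex. -/
def K.vertex (p : L) : K L :=
  ⟨Finsupp.single p 1, by
    refine ⟨fun q => ?_, by simp, ?_⟩
    · classical
      rw [Finsupp.single_apply]
      split_ifs <;> norm_num
    · rw [Finsupp.support_single_ne_zero p one_ne_zero, Finset.coe_singleton]
      exact Set.subsingleton_singleton.isChain⟩

/-- `p 0 < p 1 < ... < p n` is a maximal chain. -/
def IsMaxChainSeq {n : ℕ} (p : Fin (n + 1) → L) : Prop :=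
  StrictMono p ∧ IsMaxChain (· ≤ ·) (Set.range p)

/-- The `j`-th vertex `e_1 + ... + e_j` of the `n`-dimensional orthoscheme
(coordinates are numbered from `0`, so that `e_1` is the unit vector of coordinate `0`). -/
def orthoVertex (n : ℕ) (j : Fin (n + 1)) : Fin n → ℝ :=
  fun i => if i.castSucc < j then 1 else 0

/-- The map from the maximal simplex of the chain `p` to the orthoscheme. -/
def phi {n : ℕ} (p : Fin (n + 1) → L) (x : K L) : Fin n → ℝ :=
  ∑ j : Fin (n + 1), x.coeff (p j) • orthoVertex n j

/-- The `l_q`-distance on the maximal simplex of the chain `p`. -/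
def simplexDist (q : ENNReal) {n : ℕ} (p : Fin (n + 1) → L) (x y : K L) : ℝ :=
  ‖WithLp.toLp q (phi p x - phi p y)‖

/-- `IsStringLength q x y l`: there is a finite sequence of points from `x` to `y`, any two
consecutive ones lying in a common maximal simplex, such that the `l_q`-distances of consecutive
points (measured in these simplices) add up to `l`. -/
inductive IsStringLength (q : ENNReal) : K L → K L → ℝ → Prop
  | nil (x : K L) : IsStringLength q x x 0
  | cons {n : ℕ} (p : Fin (n + 1) → L) (hp : IsMaxChainSeq p) (x y z : K L) (l : ℝ)
      (hx : x.supp ⊆ Set.range p) (hy : y.supp ⊆ Set.range p) (h : IsStringLength q y z l) :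
      IsStringLength q x z (simplexDist q p x y + l)

/-- The intrinsic `l_q`-metric of the complex: the infimum of the lengths of strings. -/
def pathDist (q : ENNReal) (x y : K L) : ℝ := sInf {l | IsStringLength q x y l}

/-- The metric of the orthoscheme complex. -/
def d (x y : K L) : ℝ := pathDist 2 x y

/-- The `l_1`-metric on the complex. -/
def d1 (x y : K L) : ℝ := pathDist 1 x y

/-- The function `- C d_1 + ε d ^ 2`, the distances being taken from the vertex `0`. -/
def objective (C ε : ℝ) (x : K L) : ℝ :=
  -C * d1 (K.vertex ⊥) x + ε * d (K.vertex ⊥) x ^ 2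

/-- The set of minimizers over `y` of `f y + d x y ^ 2 / (2 lam)`. -/
def proxSet (f : K L → ℝ) (lam : ℝ) (x : K L) : Set (K L) :=
  {y | ∀ z, f y + 1 / (2 * lam) * d x y ^ 2 ≤ f z + 1 / (2 * lam) * d x z ^ 2}

/-- `J` is the resolvent of `f` with parameter `lam`: for all `x`, the point `J x` is the unique
minimizer of `f y + d x y ^ 2 / (2 lam)` over `y`. -/
def IsResolvent (f : K L → ℝ) (lam : ℝ) (J : K L → K L) : Prop :=
  ∀ x, proxSet f lam x = {J x}

/-- A base of a lattice of rank `n`: `n` atoms with join `1`. -/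
def IsBase {n : ℕ} (a : Fin n → L) : Prop :=
  (∀ i, IsAtom (a i)) ∧ Finset.univ.sup a = ⊤

/-- The frame of a base: all joins of subsets of the base. -/
def frame {n : ℕ} (a : Fin n → L) : Set L := Set.range fun S : Finset (Fin n) => S.sup a

/-- The `i`-th coordinate, with respect to the frame of `a`, of a point supported on the frame:
the image under the linear map sending the join of `S` to the indicator vector of `S`. -/
def frameCoord {n : ℕ} (a : Fin n → L) (x : K L) (i : Fin n) : ℝ :=
  ∑ S : Finset (Fin n), x.coeff (S.sup a) * (if i ∈ S then 1 else 0)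

/-- The formal sum of the `c i • p i` over a chain `p 0 < ... < p (k - 1)` is the point `x`.
Coefficients may be zero. -/
def Represents {k : ℕ} (p : Fin k → L) (c : Fin k → ℝ) (x : K L) : Prop :=
  StrictMono p ∧ x.1 = ∑ i, Finsupp.single (p i) (c i)

end Complex

/-! ### Random access machines with a number memory and an element memory -/

/-- Instructions.  The machine has index registers `I[i]` holding natural numbers, an array `N` of
numbers and an array `E` of lattice elements; the arrays are addressed through the index registers.
Lattice elements are black boxes: they can be copied and compared, and `0`, `1` are available. -/
inductive Instr : Type
  /-- `I[i] := c` -/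
  | idxConst (i c : ℕ)
  /-- `I[i] := I[j] + I[k]` -/
  | idxAdd (i j k : ℕ)
  /-- `I[i] := max (I[j] - I[k]) 0` -/
  | idxSub (i j k : ℕ)
  /-- `N[I[i]] := 0` -/
  | numZero (i : ℕ)
  /-- `N[I[i]] := 1` -/
  | numOne (i : ℕ)
  /-- `N[I[i]] := N[I[j]]` -/
  | numCopy (i j : ℕ)
  /-- `N[I[i]] := N[I[j]] + N[I[k]]` -/
  | numAdd (i j k : ℕ)
  /-- `N[I[i]] := N[I[j]] - N[I[k]]` -/
  | numSub (i j k : ℕ)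
  /-- `N[I[i]] := N[I[j]] * N[I[k]]` -/
  | numMul (i j k : ℕ)
  /-- `N[I[i]] := N[I[j]] / N[I[k]]` (and `0` if the divisor is zero) -/
  | numDiv (i j k : ℕ)
  /-- `E[I[i]] := 0` -/
  | eltBot (i : ℕ)
  /-- `E[I[i]] := 1` -/
  | eltTop (i : ℕ)
  /-- `E[I[i]] := E[I[j]]` -/
  | eltCopy (i j : ℕ)
  /-- go to line `l` if `I[i] ≤ I[j]` -/
  | jumpIdx (i j l : ℕ)
  /-- go to line `l` if `N[I[i]] ≤ N[I[j]]` -/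
  | jumpNum (i j l : ℕ)
  /-- go to line `l` if `E[I[i]] ≤ E[I[j]]` -/
  | jumpElt (i j l : ℕ)

/-- A program is a finite list of instructions. -/
abbrev Program : Type := List Instr

/-- A configuration: program counter, index registers, number array, element array. -/
structure Config (L : Type u) : Type u where
  pc : ℕ
  idx : ℕ → ℕ
  num : ℕ → ℝ
  elt : ℕ → L

section Machine

variable {L : Type u} [Lattice L] [BoundedOrder L]

/-- Set an index register and advance. -/
def Config.setIdx (s : Config L) (i v : ℕ) : Config L :=
  { s with pc := s.pc + 1, idx := Function.update s.idx i v }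

/-- Set the cell `N[I[i]]` and advance. -/
def Config.setNum (s : Config L) (i : ℕ) (v : ℝ) : Config L :=
  { s with pc := s.pc + 1, num := Function.update s.num (s.idx i) v }

/-- Set the cell `E[I[i]]` and advance. -/
def Config.setElt (s : Config L) (i : ℕ) (v : L) : Config L :=
  { s with pc := s.pc + 1, elt := Function.update s.elt (s.idx i) v }

/-- The number `N[I[i]]`. -/
def Config.getNum (s : Config L) (i : ℕ) : ℝ := s.num (s.idx i)

/-- The element `E[I[i]]`. -/
def Config.getElt (s : Config L) (i : ℕ) : L := s.elt (s.idx i)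

open Classical in
/-- Jump to line `l` if `c` holds, otherwise advance. -/
def Config.jumpIf (s : Config L) (c : Prop) (l : ℕ) : Config L :=
  { s with pc := if c then l else s.pc + 1 }

/-- The effect of one instruction. -/
def Instr.exec (s : Config L) : Instr → Config L
  | .idxConst i c => s.setIdx i c
  | .idxAdd i j k => s.setIdx i (s.idx j + s.idx k)
  | .idxSub i j k => s.setIdx i (s.idx j - s.idx k)
  | .numZero i => s.setNum i 0
  | .numOne i => s.setNum i 1
  | .numCopy i j => s.setNum i (s.getNum j)
  | .numAdd i j k => s.setNum i (s.getNum j + s.getNum k)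
  | .numSub i j k => s.setNum i (s.getNum j - s.getNum k)
  | .numMul i j k => s.setNum i (s.getNum j * s.getNum k)
  | .numDiv i j k => s.setNum i (s.getNum j / s.getNum k)
  | .eltBot i => s.setElt i ⊥
  | .eltTop i => s.setElt i ⊤
  | .eltCopy i j => s.setElt i (s.getElt j)
  | .jumpIdx i j l => s.jumpIf (s.idx i ≤ s.idx j) l
  | .jumpNum i j l => s.jumpIf (s.getNum i ≤ s.getNum j) l
  | .jumpElt i j l => s.jumpIf (s.getElt i ≤ s.getElt j) l

/-- One step of the machine; the machine has halted when the program counter has left the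
program. -/
def Program.step (P : Program) (s : Config L) : Config L :=
  match P[s.pc]? with
  | some i => i.exec s
  | none => s

/-- The configuration after `t` steps. -/
def Program.run (P : Program) (t : ℕ) (s : Config L) : Config L := (P.step)^[t] s

/-- The machine has halted. -/
def Program.Halted (P : Program) (s : Config L) : Prop := P.length ≤ s.pc

/-- The initial configuration on input `C`, `ε`, `lam` and the formal sum of the `c i • p i`:
`I[0] = k`; `N` starts with `C, ε, lam, c 0, ..., c (k - 1)`; `E` starts with three unused cells
and `p 0, ..., p (k - 1)`; all other entries are zero. -/
def initConfig (C ε lam : ℝ) {k : ℕ} (p : Fin k → L) (c : Fin k → ℝ) : Config L where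
  pc := 0
  idx := fun i => if i = 0 then k else 0
  num := fun a =>
    if a = 0 then C else if a = 1 then ε else if a = 2 then lam else
      if h : a - 3 < k then c ⟨a - 3, h⟩ else 0
  elt := fun a =>
    if a < 3 then ⊥ else if h : a - 3 < k then p ⟨a - 3, h⟩ else ⊥

/-- The configuration holds, as its output, a formal sum over a chain that is the point `x`:
it has `I[0]` terms, and its coefficients and its elements are stored in consecutive cells from
address `I[1]` on. -/
def Config.Outputs (s : Config L) (x : K L) : Prop :=
  Represents (fun i : Fin (s.idx 0) => s.elt (s.idx 1 + i))
    (fun i : Fin (s.idx 0) => s.num (s.idx 1 + i)) x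

end Machine

/-- The bit length of a rational number. -/
def ratSize (r : ℚ) : ℕ := Nat.size r.num.natAbs + Nat.size r.den

end Ortho

end

namespace Ortho

/-! ### Jumps along a maximal chain, bases and frames -/

section ModularLattice

variable {L : Type u} [Lattice L]

/-! Fix a maximal chain `c`. Let the `i`-th coordinate of a point `y` be the total coefficient in
`y` of those elements whose meets with the two ends of the `i`-th step of `c` differ (`jumpCoord`).
By modularity a covering step of the lattice adds exactly one such position (`jumps_covBy`), so
every maximal chain runs through all positions in some order (`exists_jump_order`). Hence the
coordinates restrict to the orthoscheme map, up to a permutation, on every maximal simplex. They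
never increase distances, and they preserve distances between points of a common simplex
(`pathDist_eq_norm`). Since the vertex `⊥` lies in all maximal simplices, the objective is a
separable function of the coordinates.

Now let `c` contain the support of `x`. The function to be minimized is at least a sum of
one-variable strongly convex functions on `[0,1]`, each minimized by `clip`. The vector of
minimizers is attained: applying the monotone function `clip` to the masses of all proper upper sets
gives a point (`IsClip`) whose support adds at most `⊥` and `⊤` to that of `x`, so it lies in the
simplex of `c`, where the lower bound is an equality. Strong convexity determines the coordinates of
any minimizer, and `eq_of_jumpCoord_eq` determines the minimizer. Frame coordinates are masses of
upper sets too, so the same formula holds in every frame.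

Along a chain, the new coefficients are differences of consecutive clipped tail sums, which one
downward pass computes. Each stored number is an expression of bounded size in the parameters and
tail sums of the input, so bit lengths do not build up over the passes. -/

lemma inf_wcovBy_inf_of_covBy [IsModularLattice L] {a b : L} (h : a ⋖ b) (p : L) :
    p ⊓ a ⩿ p ⊓ b := by
  refine ⟨inf_le_inf_left p h.le, fun z h1 h2 => ?_⟩
  have hzp : z ≤ p := h2.le.trans inf_le_left
  rcases h.eq_or_eq (le_sup_right : a ≤ z ⊔ a)
    (sup_le (h2.le.trans inf_le_right) h.le) with h3 | h3
  · exact h1.not_ge (le_inf hzp (sup_eq_right.1 h3))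
  -- Here `z ⊔ a = b`, so `p ⊓ b = z ⊔ (a ⊓ p) = z` by the modular law.
  · refine h2.ne ?_
    rw [← h3, inf_comm, sup_inf_assoc_of_le a hzp, inf_comm, sup_eq_left.2 h1.le]

lemma wcovBy_sup_of_isAtom [OrderBot L] [IsModularLattice L] {a : L} (h : IsAtom a) (p : L) :
    p ⩿ p ⊔ a := by
  refine ⟨le_sup_left, fun z h1 h2 => ?_⟩
  have h3 : z = p ⊔ a ⊓ z := by
    rw [← sup_inf_assoc_of_le a h1.le, inf_eq_right.2 h2.le]
  rcases h.le_iff.1 (inf_le_left : a ⊓ z ≤ a) with h4 | h4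
  · rw [h4, sup_bot_eq] at h3
    exact h1.ne h3.symm
  · rw [h4] at h3
    exact h2.ne h3

/-- A discrete intermediate value principle, used to locate the step at which a chain loses a
property. -/
lemma exists_castSucc_succ {n : ℕ} {P : Fin (n + 1) → Prop} (h0 : P 0) (h1 : ¬ P (Fin.last n)) :
    ∃ i : Fin n, P i.castSucc ∧ ¬ P i.succ := by
  by_contra! h
  exact h1 (Fin.induction (motive := P) h0 h _)

namespace IsMaxChainSeq

variable {n m : ℕ} {c : Fin (n + 1) → L} {p : Fin (m + 1) → L}

lemma covBy (hc : IsMaxChainSeq c) (i : Fin n) : c i.castSucc ⋖ c i.succ := by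
  refine ⟨hc.1 i.castSucc_lt_succ, fun z h1 h2 => ?_⟩
  have key : ∀ j, c j ≤ z ∨ z ≤ c j := fun j => by
    rcases le_or_gt j i.castSucc with h | h
    · exact Or.inl ((hc.1.monotone h).trans h1.le)
    · exact Or.inr (h2.le.trans (hc.1.monotone (Fin.castSucc_lt_iff_succ_le.1 h)))
  have hz : z ∈ Set.range c := by
    rw [hc.2.2 (t := insert z (Set.range c)) (hc.2.1.insert ?_) (Set.subset_insert _ _)]
    · exact Set.mem_insert _ _
    · rintro _ ⟨j, rfl⟩ -
      exact (key j).symm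
  obtain ⟨j, rfl⟩ := hz
  have h3 := hc.1.lt_iff_lt.1 h1
  have h4 := hc.1.lt_iff_lt.1 h2
  exact absurd (Fin.castSucc_lt_iff_succ_le.1 h3) (not_le.2 h4)

lemma apply_zero [BoundedOrder L] (hc : IsMaxChainSeq c) : c 0 = ⊥ := by
  obtain ⟨j, hj⟩ := hc.2.bot_mem
  exact le_bot_iff.1 (hj ▸ hc.1.monotone (Fin.zero_le j))

lemma apply_last [BoundedOrder L] (hc : IsMaxChainSeq c) : c (Fin.last n) = ⊤ := by
  obtain ⟨j, hj⟩ := hc.2.top_mem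
  exact top_le_iff.1 (hj ▸ hc.1.monotone (Fin.le_last j))

end IsMaxChainSeq

/-- The elements whose meets with the `i`-th and the next element of the chain `c` differ. -/
def jumpSet {n : ℕ} (c : Fin (n + 1) → L) (i : Fin n) : Set L :=
  {p | p ⊓ c i.castSucc ≠ p ⊓ c i.succ}

open Classical in
/-- The positions at which the meets of `p` with the chain `c` jump. -/
noncomputable def jumps {n : ℕ} (c : Fin (n + 1) → L) (p : L) : Finset (Fin n) :=
  Finset.univ.filter fun i => p ∈ jumpSet c i

lemma mem_jumps {n : ℕ} {c : Fin (n + 1) → L} {p : L} {i : Fin n} :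
    i ∈ jumps c p ↔ p ∈ jumpSet c i := by
  simp [jumps]

lemma mem_jumpSet {n : ℕ} {c : Fin (n + 1) → L} {p : L} {i : Fin n} :
    p ∈ jumpSet c i ↔ p ⊓ c i.castSucc ≠ p ⊓ c i.succ := Iff.rfl

lemma isUpperSet_jumpSet {n : ℕ} (c : Fin (n + 1) → L) (i : Fin n) :
    IsUpperSet (jumpSet c i) := by
  intro p q hpq hp h
  apply hp
  have := congrArg (p ⊓ ·) h
  simpa [← inf_assoc, inf_eq_left.2 hpq] using this

lemma jumps_mono {n : ℕ} (c : Fin (n + 1) → L) : Monotone (jumps c) :=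
  fun _ _ h i hi => mem_jumps.2 (isUpperSet_jumpSet c i h (mem_jumps.1 hi))

lemma apply_mem_jumpSet {n : ℕ} {c : Fin (n + 1) → L} (hc : StrictMono c) (j : Fin (n + 1))
    (i : Fin n) : c j ∈ jumpSet c i ↔ i.castSucc < j := by
  rw [mem_jumpSet]
  constructor
  · intro h
    by_contra! hj
    apply h
    rw [inf_eq_left.2 (hc.monotone hj),
      inf_eq_left.2 (hc.monotone (hj.trans i.castSucc_lt_succ.le))]
  · intro h
    rw [inf_eq_right.2 (hc.monotone h.le),
      inf_eq_right.2 (hc.monotone (Fin.castSucc_lt_iff_succ_le.1 h))]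
    exact (hc i.castSucc_lt_succ).ne

variable [BoundedOrder L]

lemma bot_notMem_jumpSet {n : ℕ} (c : Fin (n + 1) → L) (i : Fin n) : ⊥ ∉ jumpSet c i := by
  simp [jumpSet]

lemma top_mem_jumpSet {n : ℕ} {c : Fin (n + 1) → L} (hc : StrictMono c) (i : Fin n) :
    ⊤ ∈ jumpSet c i := by
  simpa [jumpSet] using (hc i.castSucc_lt_succ).ne

lemma jumps_bot {n : ℕ} (c : Fin (n + 1) → L) : jumps c ⊥ = ∅ :=
  Finset.eq_empty_of_forall_notMem fun i hi => bot_notMem_jumpSet c i (mem_jumps.1 hi)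

lemma jumps_top {n : ℕ} {c : Fin (n + 1) → L} (hc : StrictMono c) :
    jumps c ⊤ = Finset.univ :=
  Finset.eq_univ_of_forall fun i => mem_jumps.2 (top_mem_jumpSet hc i)

/-- The new position is the step `i` at which `q ⊓ c j` stops lying below `p`. Up to there the meets
of `p` and `q` with `c` agree; beyond it `q ⊓ c j` joins with `p` to `q`, so its meet with `p`
governs whether it grows. -/
lemma jumps_covBy [IsModularLattice L] {n : ℕ} {c : Fin (n + 1) → L} (hc : IsMaxChainSeq c)
    {p q : L} (h : p ⋖ q) : ∃ i, i ∉ jumps c p ∧ jumps c q = insert i (jumps c p) := by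
  obtain ⟨i, hi1, hi2⟩ := exists_castSucc_succ (P := fun j => q ⊓ c j ≤ p)
    (by simp [hc.apply_zero]) (by simpa [hc.apply_last] using h.lt.not_ge)
  have low : ∀ j, j ≤ i.castSucc → q ⊓ c j = p ⊓ c j := fun j hj =>
    le_antisymm (le_inf ((inf_le_inf_left q (hc.1.monotone hj)).trans hi1) inf_le_right)
      (inf_le_inf_right _ h.le)
  have high : ∀ j, i.succ ≤ j → q ⊓ c j ⊔ p = q := fun j hj => by
    refine (h.eq_or_eq le_sup_right (sup_le inf_le_left h.le)).resolve_left fun h3 => hi2 ?_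
    exact (inf_le_inf_left q (hc.1.monotone hj)).trans (sup_eq_right.1 h3)
  have hpi : i ∉ jumps c p := by
    rw [mem_jumps, mem_jumpSet, not_not]
    -- Otherwise `p ⊓ c i.succ` lies strictly between `q ⊓ c i.castSucc` and `q ⊓ c i.succ`.
    by_contra h3
    have hw := inf_wcovBy_inf_of_covBy (hc.covBy i) q
    rw [low _ le_rfl] at hw
    refine hw.2 (lt_of_le_of_ne (inf_le_inf_left p (hc.covBy i).le) h3)
      (lt_of_le_of_ne (inf_le_inf_right _ h.le) fun h4 => hi2 (h4 ▸ inf_le_left))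
  refine ⟨i, hpi, Finset.Subset.antisymm (fun j hj => ?_) (Finset.insert_subset ?_
    (jumps_mono c h.le))⟩
  · rw [Finset.mem_insert, or_iff_not_imp_left]
    intro hji
    rw [mem_jumps, mem_jumpSet] at hj ⊢
    rcases lt_or_gt_of_ne hji with h3 | h3
    · rwa [low _ (Fin.castSucc_le_castSucc_iff.2 h3.le),
        low _ (Fin.castSucc_lt_iff_succ_le.1 (Fin.castSucc_lt_castSucc_iff.2 h3))] at hj
    · intro h4
      -- Modular cancellation: comparable elements with the same meet and the same join with `p` are
      -- equal.
      refine hj (eq_of_le_of_inf_le_of_sup_le (z := p)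
        (inf_le_inf_left q (hc.covBy j).le) ?_ ?_)
      · rw [inf_right_comm, inf_eq_right.2 h.le, inf_right_comm, inf_eq_right.2 h.le, h4]
      · rw [high _ (Fin.castSucc_lt_iff_succ_le.1 (Fin.castSucc_lt_castSucc_iff.2 h3)),
          high _ (Fin.succ_le_succ_iff.2 h3.le)]
  · rw [mem_jumps, mem_jumpSet]
    intro h3
    exact hi2 (h3 ▸ hi1)

/-- Along a maximal chain `p`, the positions of the jumps of the chain `c` are added one by
one. -/
lemma exists_jump_order [IsModularLattice L] {n m : ℕ} {c : Fin (n + 1) → L}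
    {p : Fin (m + 1) → L} (hc : IsMaxChainSeq c) (hp : IsMaxChainSeq p) :
    ∃ σ : Fin m ≃ Fin n, ∀ i j, p j ∈ jumpSet c (σ i) ↔ i.castSucc < j := by
  choose σ h1 h2 using fun i => jumps_covBy hc (hp.covBy i)
  have mem : ∀ i j, i.castSucc < j → σ i ∈ jumps c (p j) := fun i j hij =>
    jumps_mono c (hp.1.monotone (Fin.castSucc_lt_iff_succ_le.1 hij))
      (by rw [h2]; exact Finset.mem_insert_self _ _)
  have notMem : ∀ i j, j ≤ i.castSucc → σ i ∉ jumps c (p j) := fun i j hij h =>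
    h1 i (jumps_mono c (hp.1.monotone hij) h)
  have inj : Function.Injective σ := by
    have : ∀ i j, i < j → σ i ≠ σ j := fun i j hij h =>
      h1 j (h ▸ mem i _ (Fin.castSucc_lt_castSucc_iff.2 hij))
    intro i j h
    by_contra hij
    rcases lt_or_gt_of_ne hij with h3 | h3
    · exact this _ _ h3 h
    · exact this _ _ h3 h.symm
  -- Position `k` is absent at `⊥` and present at `⊤`, so some step adds it.
  have surj : Function.Surjective σ := by
    intro k
    obtain ⟨i, hi1, hi2⟩ := exists_castSucc_succ (P := fun j => k ∉ jumps c (p j))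
      (by simp [hp.apply_zero, jumps_bot]) (by simp [hp.apply_last, jumps_top hc.1])
    rw [not_not, h2, Finset.mem_insert] at hi2
    exact ⟨i, (hi2.resolve_right hi1).symm⟩
  refine ⟨Equiv.ofBijective σ (show σ.Bijective from ⟨inj, surj⟩), fun i j => ?_⟩
  rw [Equiv.ofBijective_apply, ← mem_jumps]
  exact ⟨fun h => not_le.1 fun h' => notMem i j h' h, mem i j⟩

/-- The bijection of `exists_jump_order` forces all maximal chains to have equal length
(Jordan–Hölder), and one of them extends a chain that attains the height. -/
lemma exists_isMaxChainSeq [IsModularLattice L] {n : ℕ} (hn : Order.height (⊤ : L) = n)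
    {s : Set L} (hs : IsMaxChain (· ≤ ·) s) :
    ∃ c : Fin (n + 1) → L, IsMaxChainSeq c ∧ Set.range c = s := by
  classical
  have bound : ∀ (m : ℕ) (f : Fin (m + 1) → L), StrictMono f → m ≤ n := fun m f hf => by
    have := Order.length_le_height (p := LTSeries.mk m f hf) (x := (⊤ : L)) le_top
    rw [hn] at this
    exact_mod_cast this
  have conv : ∀ s : Set L, IsMaxChain (· ≤ ·) s → ∃ (m : ℕ) (c : Fin (m + 1) → L),
      IsMaxChainSeq c ∧ Set.range c = s := by
    intro s hs
    set F : Flag L := Flag.ofIsMaxChain s hs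
    have hFs : ∀ p, p ∈ F ↔ p ∈ s := fun p => Iff.rfl
    have hfin : Finite F := by
      by_contra hF
      rw [not_finite_iff_infinite] at hF
      -- A chain of `n + 2` elements has length `n + 1`, more than the height.
      obtain ⟨t, ht⟩ := Infinite.exists_subset_card_eq F (n + 2)
      have := bound (n + 1) (fun i => (t.orderEmbOfFin ht i : L))
        (fun i j hij => (t.orderEmbOfFin ht).strictMono hij)
      omega
    have := Fintype.ofFinite F
    have hpos : 0 < Fintype.card F := Fintype.card_pos_iff.2 ⟨⟨⊥, F.bot_mem⟩⟩
    obtain ⟨m, hm⟩ := Nat.exists_eq_succ_of_ne_zero hpos.ne'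
    let e := Fintype.orderIsoFinOfCardEq F hm
    have hr : Set.range (fun i => (e i : L)) = s := by
      ext p
      constructor
      · rintro ⟨i, rfl⟩
        exact (e i).2
      · intro hp
        exact ⟨e.symm ⟨p, hp⟩, by simp⟩
    refine ⟨m, fun i => (e i : L), ⟨fun i j hij => e.strictMono hij, ?_⟩, hr⟩
    rw [hr]
    exact hs
  obtain ⟨w, hw, hlen⟩ := Order.exists_series_of_height_eq_coe (⊤ : L) hn
  obtain ⟨M, hM, hwM⟩ := (w.strictMono.monotone.isChain_range (β := L)).exists_maxChain
  obtain ⟨m, c, hc, hcM⟩ := conv M hM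
  obtain ⟨k, p, hp, hps⟩ := conv s hs
  obtain ⟨σ, -⟩ := exists_jump_order hc hp
  have hkm : k = m := by simpa using Fintype.card_congr σ
  have h1 : m ≤ n := bound m c hc.1
  have h2 : n ≤ m := by
    have h3 := Set.ncard_le_ncard hwM (hcM ▸ Set.finite_range c)
    rw [← hcM, ← Set.image_univ, ← Set.image_univ, Set.ncard_image_of_injective _ hc.1.injective,
      Set.ncard_image_of_injective _ w.strictMono.injective, Set.ncard_univ, Set.ncard_univ] at h3
    simp at h3
    omega
  obtain rfl : n = k := by omega
  exact ⟨p, hp, hps⟩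

/-- The number of jumps acts as a rank function: joining an atom raises it by at most one. -/
lemma card_jumps_sup_le [IsModularLattice L] {n k : ℕ} {c : Fin (n + 1) → L}
    (hc : IsMaxChainSeq c) {a : Fin k → L} (ha : ∀ i, IsAtom (a i)) (S : Finset (Fin k)) :
    (jumps c (S.sup a)).card ≤ S.card := by
  induction S using Finset.induction_on with
  | empty => simp [jumps_bot]
  | insert i S hi ih =>
    rw [Finset.sup_insert, Finset.card_insert_of_notMem hi, sup_comm]
    rcases (wcovBy_sup_of_isAtom (ha i) (S.sup a)).covBy_or_eq with h | h
    · obtain ⟨j, h1, h2⟩ := jumps_covBy hc h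
      rw [h2, Finset.card_insert_of_notMem h1]
      omega
    · rw [← h]
      omega

/-- Independence of a base: if `a i` were below the join of other atoms, the remaining `n - 1` atoms
would join to `⊤`, which has `n` jumps. -/
lemma IsBase.le_sup_iff [IsModularLattice L] {n : ℕ} (hn : Order.height (⊤ : L) = n)
    {a : Fin n → L} (ha : IsBase a) (i : Fin n) (S : Finset (Fin n)) :
    a i ≤ S.sup a ↔ i ∈ S := by
  refine ⟨fun h => ?_, fun h => Finset.le_sup h⟩
  by_contra hi
  obtain ⟨M, hM, -⟩ := (IsChain.empty (α := L) (r := (· ≤ ·))).exists_maxChain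
  obtain ⟨c, hc, -⟩ := exists_isMaxChainSeq hn hM
  have h1 : (Finset.univ.erase i).sup a = ⊤ := by
    rw [← top_le_iff, ← ha.2, ← Finset.insert_erase (Finset.mem_univ i), Finset.sup_insert,
      Finset.erase_insert (Finset.notMem_erase _ _)]
    refine sup_le (h.trans (Finset.sup_mono fun j hj => Finset.mem_erase.2 ⟨?_, by simp⟩)) le_rfl
    rintro rfl
    exact hi hj
  have h2 := card_jumps_sup_le hc ha.1 (Finset.univ.erase i)
  rw [h1, jumps_top hc.1, Finset.card_erase_of_mem (Finset.mem_univ i)] at h2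
  simp at h2
  have := i.2
  omega

lemma IsBase.sup_injective [IsModularLattice L] {n : ℕ} (hn : Order.height (⊤ : L) = n)
    {a : Fin n → L} (ha : IsBase a) : Function.Injective fun S : Finset (Fin n) => S.sup a := by
  intro S T h
  ext i
  rw [← ha.le_sup_iff hn, ← ha.le_sup_iff hn]
  exact iff_of_eq (congrArg (a i ≤ ·) h)

lemma bot_mem_frame {n : ℕ} (a : Fin n → L) : ⊥ ∈ frame a := ⟨∅, Finset.sup_empty⟩

lemma IsBase.top_mem_frame {n : ℕ} {a : Fin n → L} (ha : IsBase a) : ⊤ ∈ frame a :=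
  ⟨Finset.univ, ha.2⟩

/-- For a complement `b` of `p`, the element `b ⊓ q` complements `p` inside `[⊥, q]`; modular
cancellation makes it an atom because `p ⋖ q`. -/
lemma exists_atom_of_covBy [IsModularLattice L] [ComplementedLattice L] {p q : L} (h : p ⋖ q) :
    ∃ a, IsAtom a ∧ p ⊔ a = q := by
  obtain ⟨b, hb⟩ := exists_isCompl p
  have h1 : p ⊔ b ⊓ q = q := by
    rw [← sup_inf_assoc_of_le b h.le, hb.sup_eq_top, top_inf_eq]
  have h2 : p ⊓ (b ⊓ q) = ⊥ := by rw [← inf_assoc, hb.inf_eq_bot, bot_inf_eq]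
  refine ⟨b ⊓ q, ⟨fun h3 => h.ne (by rw [← h1, h3, sup_bot_eq]), fun z hz => ?_⟩, h1⟩
  rcases h.eq_or_eq (le_sup_left : p ≤ p ⊔ z)
    (sup_le h.le (hz.le.trans inf_le_right)) with h3 | h3
  · exact le_bot_iff.1 (h2 ▸ le_inf (sup_eq_left.1 h3) hz.le)
  · refine absurd (eq_of_le_of_inf_le_of_sup_le (z := p) hz.le ?_ ?_) hz.ne
    · rw [inf_comm, h2]
      exact bot_le
    · rw [sup_comm, h1, sup_comm, h3]

/-- One atom per step of the chain: each chain element is the join of the atoms of the steps below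
it. -/
lemma exists_isBase_range_subset_frame [IsModularLattice L] [ComplementedLattice L] {n : ℕ}
    {c : Fin (n + 1) → L} (hc : IsMaxChainSeq c) :
    ∃ a : Fin n → L, IsBase a ∧ Set.range c ⊆ frame a := by
  classical
  choose a ha1 ha2 using fun i => exists_atom_of_covBy (hc.covBy i)
  have key : ∀ j, (Finset.univ.filter fun i : Fin n => i.castSucc < j).sup a = c j := by
    refine fun j => Fin.induction ?_ (fun j ih => ?_) j
    · simp [hc.apply_zero]
    · rw [← ha2 j, ← ih, sup_comm, ← Finset.sup_insert]
      congr 1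
      ext i
      simp [Fin.castSucc_lt_succ_iff, le_iff_eq_or_lt]
  refine ⟨a, ⟨ha1, ?_⟩, ?_⟩
  · rw [← hc.apply_last, ← key]
    congr 1
    ext i
    simp [Fin.castSucc_lt_last]
  · rintro _ ⟨j, rfl⟩
    exact ⟨_, key j⟩

end ModularLattice

/-! ### Masses of sets of lattice elements -/

section Mass

variable {L : Type u}

/-- The total coefficient of the elements of `W`. -/
noncomputable def weight (W : Set L) : (L →₀ ℝ) →ₗ[ℝ] ℝ :=
  Finsupp.linearCombination ℝ (W.indicator fun _ => (1 : ℝ))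

open Classical in
lemma weight_single (W : Set L) (p : L) (r : ℝ) :
    weight W (Finsupp.single p r) = if p ∈ W then r else 0 := by
  simp [weight, Set.indicator_apply]

open Classical in
lemma weight_apply (W : Set L) (x : L →₀ ℝ) :
    weight W x = ∑ p ∈ x.support, if p ∈ W then x p else 0 := by
  simp [weight, Finsupp.linearCombination_apply, Finsupp.sum, Set.indicator_apply]

variable [Lattice L]

namespace K

/-- The total coefficient in `x` of the elements of `W`. -/
noncomputable def mass (x : K L) (W : Set L) : ℝ := weight W x.1

lemma coeff_nonneg (x : K L) (p : L) : 0 ≤ x.coeff p := x.2.1 p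

lemma mem_supp {x : K L} {p : L} : p ∈ x.supp ↔ x.coeff p ≠ 0 := by
  simp [supp, coeff]

lemma coeff_pos {x : K L} {p : L} (hp : p ∈ x.supp) : 0 < x.coeff p :=
  (x.coeff_nonneg p).lt_of_ne (mem_supp.1 hp).symm

open Classical in
lemma mass_eq_sum (x : K L) (W : Set L) :
    x.mass W = ∑ p ∈ x.1.support, if p ∈ W then x.coeff p else 0 := weight_apply W x.1

lemma mass_mono {x : K L} {V W : Set L} (h : x.supp ∩ V ⊆ W) : x.mass V ≤ x.mass W := by
  classical
  rw [mass_eq_sum, mass_eq_sum]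
  refine Finset.sum_le_sum fun p hp => ?_
  by_cases hV : p ∈ V
  · rw [if_pos hV, if_pos (h ⟨hp, hV⟩)]
  · rw [if_neg hV]
    split_ifs
    exacts [x.coeff_nonneg p, le_rfl]

lemma mass_lt_mass {x : K L} {V W : Set L} (h : x.supp ∩ V ⊆ W) {p : L} (hp : p ∈ x.supp)
    (hV : p ∉ V) (hW : p ∈ W) : x.mass V < x.mass W := by
  classical
  rw [mass_eq_sum, mass_eq_sum]
  refine Finset.sum_lt_sum (fun q hq => ?_) ⟨p, hp, ?_⟩
  · by_cases hV : q ∈ V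
    · rw [if_pos hV, if_pos (h ⟨hq, hV⟩)]
    · rw [if_neg hV]
      split_ifs
      exacts [x.coeff_nonneg q, le_rfl]
  · rw [if_neg hV, if_pos hW]
    exact coeff_pos hp

lemma mass_congr {x : K L} {V W : Set L} (h : ∀ p ∈ x.supp, p ∈ V ↔ p ∈ W) :
    x.mass V = x.mass W :=
  le_antisymm (mass_mono fun p hp => (h p hp.1).1 hp.2) (mass_mono fun p hp => (h p hp.1).2 hp.2)

lemma mass_univ (x : K L) : x.mass Set.univ = 1 := by
  rw [mass_eq_sum]
  simpa [Finsupp.sum, coeff] using x.2.2.1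

lemma mass_empty (x : K L) : x.mass ∅ = 0 := by
  simp [mass_eq_sum]

lemma mass_nonneg (x : K L) (W : Set L) : 0 ≤ x.mass W :=
  x.mass_empty ▸ mass_mono (by simp)

lemma mass_le_one (x : K L) (W : Set L) : x.mass W ≤ 1 :=
  x.mass_univ ▸ mass_mono (by simp)

/-- This makes the masses of upper sets a complete system of coordinates. -/
lemma coeff_eq_mass_sub_mass (x : K L) (p : L) :
    x.coeff p = x.mass (Set.Ici p) - x.mass (Set.Ioi p) := by
  classical
  rw [mass_eq_sum, mass_eq_sum, ← Finset.sum_sub_distrib]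
  rw [Finset.sum_eq_single p]
  · simp
  · intro q _ hq
    have : q ∈ Set.Ici p ↔ q ∈ Set.Ioi p := ⟨fun h => lt_of_le_of_ne h hq.symm, fun h => le_of_lt h⟩
    simp [this]
  · intro h
    simpa [coeff] using h

lemma ext_coeff {x y : K L} (h : ∀ p, x.coeff p = y.coeff p) : x = y :=
  Subtype.ext (Finsupp.ext h)

lemma isChain_supp (x : K L) : IsChain (· ≤ ·) x.supp := x.2.2.2

/-- A point is determined by the masses of the proper upper sets. -/
lemma ext_mass [BoundedOrder L] {x y : K L}
    (h : ∀ W, IsUpperSet W → ⊥ ∉ W → ⊤ ∈ W → x.mass W = y.mass W) : x = y := by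
  refine ext_coeff fun p => ?_
  rw [coeff_eq_mass_sub_mass, coeff_eq_mass_sub_mass]
  congr 1
  -- The improper upper sets `Set.Ici ⊥` and `Set.Ioi ⊤` have masses `1` and `0` for every point.
  · rcases eq_or_ne p ⊥ with rfl | hp
    · simp [mass_univ]
    · exact h _ (isUpperSet_Ici p) (by simpa using hp) le_top
  · rcases eq_or_ne p ⊤ with rfl | hp
    · simp [mass_empty]
    · exact h _ (isUpperSet_Ioi p) (by simp) (Ne.lt_top hp)

lemma eq_sum_single {ι : Type*} [Fintype ι] {p : ι → L} (hp : p.Injective) {x : K L}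
    (hx : x.supp ⊆ Set.range p) : x.1 = ∑ i, Finsupp.single (p i) (x.coeff (p i)) := by
  classical
  ext q
  rw [Finsupp.finsetSum_apply]
  by_cases hq : q ∈ x.supp
  · obtain ⟨i, rfl⟩ := hx hq
    rw [Finset.sum_eq_single i (fun j _ hj => Finsupp.single_eq_of_ne (hp.ne hj.symm)) (by simp)]
    simp [coeff]
  · have hq0 : x.coeff q = 0 := not_not.1 fun h => hq (mem_supp.2 h)
    refine hq0.trans (Finset.sum_eq_zero fun i _ => ?_).symm
    rcases eq_or_ne (p i) q with h | h
    · rw [h, hq0]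
      simp
    · exact Finsupp.single_eq_of_ne h.symm

open Classical in
lemma mass_eq_sum_range {ι : Type*} [Fintype ι] {p : ι → L} (hp : p.Injective) {x : K L}
    (hx : x.supp ⊆ Set.range p) (W : Set L) :
    x.mass W = ∑ i, if p i ∈ W then x.coeff (p i) else 0 := by
  rw [mass, eq_sum_single hp hx, map_sum]
  exact Finset.sum_congr rfl fun i _ => weight_single _ _ _

end K

end Mass

/-! ### Transforming the masses of proper upper sets -/

section Clip

variable {L : Type u} [Lattice L] [BoundedOrder L]

/-- `y` arises from `x` by applying `T` to the masses of all proper upper sets. -/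
def IsClip (T : ℝ → ℝ) (x y : K L) : Prop :=
  ∀ W, IsUpperSet W → ⊥ ∉ W → ⊤ ∈ W → y.mass W = T (x.mass W)

lemma IsClip.unique {T : ℝ → ℝ} {x y z : K L} (hy : IsClip T x y) (hz : IsClip T x z) :
    y = z :=
  K.ext_mass fun W h1 h2 h3 => (hy W h1 h2 h3).trans (hz W h1 h2 h3).symm

/-- For any other `p`, the proper upper sets `Set.Ici p` and `Set.Ioi p` have equal mass in `x`,
hence in `y`. Maximal chains and frames contain `⊥` and `⊤`, so they keep containing the support. -/
lemma IsClip.supp_subset {T : ℝ → ℝ} {x y : K L} (h : IsClip T x y) :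
    y.supp ⊆ insert ⊥ (insert ⊤ x.supp) := by
  intro p hp
  by_contra hn
  simp only [Set.mem_insert_iff, not_or] at hn
  obtain ⟨h1, h2, h3⟩ := hn
  refine K.mem_supp.1 hp ?_
  rw [K.coeff_eq_mass_sub_mass, h _ (isUpperSet_Ici p) (by simpa using h1) le_top,
    h _ (isUpperSet_Ioi p) (by simp) (Ne.lt_top h2), sub_eq_zero]
  congr 1
  refine K.mass_congr fun q hq => ⟨fun h4 => lt_of_le_of_ne h4 ?_, fun h4 => le_of_lt h4⟩
  rintro rfl
  exact h3 hq

/-- The masses of the final segments `[a, e)` of a chain indexed by `[b, e)`, after an application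
of `T`; the whole chain has mass `1`. -/
noncomputable def tailMass (T : ℝ → ℝ) (c : ℕ → ℝ) (b e a : ℕ) : ℝ :=
  if a ≤ b then 1 else if a < e then T (∑ l ∈ Finset.Ico a e, c l) else 0

/-- A proper upper set meets the chain in a final segment that is neither empty nor everything, and
the differences of clipped tails telescope over it. Monotonicity of `T` keeps them nonnegative; `⊥`
and `⊤` absorb the mass that `T` moves to the ends. Indexing by an interval of `ℕ` lets the same
formula describe memory cells. -/
lemma exists_isClip_of_chain {T : ℝ → ℝ} (hT : Monotone T) (hT0 : ∀ r, 0 ≤ T r)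
    (hT1 : ∀ r, T r ≤ 1) {x : K L} {b e : ℕ} (hbe : b < e) {q : ℕ → L} {c : ℕ → ℝ}
    (hq : StrictMonoOn q (Set.Ico b e)) (hqb : q b = ⊥) (hqe : q (e - 1) = ⊤)
    (hx : x.1 = ∑ a ∈ Finset.Ico b e, Finsupp.single (q a) (c a)) :
    ∃ y : K L, y.1 = ∑ a ∈ Finset.Ico b e,
      Finsupp.single (q a) (tailMass T c b e a - tailMass T c b e (a + 1)) ∧ IsClip T x y := by
  classical
  have hc : ∀ a ∈ Finset.Ico b e, 0 ≤ c a := by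
    intro a ha
    have h1 := x.2.1 (q a)
    rw [hx, Finsupp.finsetSum_apply, Finset.sum_eq_single a] at h1
    · simpa using h1
    · intro l hl hla
      refine Finsupp.single_eq_of_ne fun h => hla (hq.injOn ?_ ?_ h.symm)
      · simpa using hl
      · simpa using ha
    · exact fun h => (h ha).elim
  set t := tailMass T c b e with ht
  have htb : t b = 1 := by simp [ht, tailMass]
  have hte : t e = 0 := by simp [ht, tailMass, hbe]
  have hanti : ∀ a, b ≤ a → a < e → t (a + 1) ≤ t a := by
    intro a hba hae
    simp only [ht, tailMass]
    rw [if_neg (by omega : ¬ a + 1 ≤ b)]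
    split_ifs with h1 h2
    · exact hT1 _
    · apply hT
      rw [← Finset.sum_Ioo_add_eq_sum_Ico hae]
      have : Finset.Ico (a + 1) e = Finset.Ioo a e := by ext; simp
      rw [this]
      linarith [hc a (Finset.mem_Ico.2 ⟨hba, hae⟩)]
    · exact zero_le_one
    · exact hT0 _
  have htel : ∀ j, b ≤ j → j ≤ e → ∑ a ∈ Finset.Ico j e, (t a - t (a + 1)) = t j := by
    intro j _ hj
    rw [Finset.sum_Ico_eq_sub _ hj, Finset.sum_range_sub', Finset.sum_range_sub', hte]
    ring
  set y : L →₀ ℝ := ∑ a ∈ Finset.Ico b e, Finsupp.single (q a) (t a - t (a + 1)) with hy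
  have hsupp : (y.support : Set L) ⊆ q '' Set.Ico b e := by
    intro p hp
    by_contra hn
    refine Finsupp.mem_support_iff.1 hp ?_
    rw [hy, Finsupp.finsetSum_apply]
    refine Finset.sum_eq_zero fun a ha => Finsupp.single_eq_of_ne ?_
    rintro rfl
    exact hn ⟨a, by simpa using ha, rfl⟩
  refine ⟨⟨y, fun p => ?_, ?_, ?_⟩, rfl, ?_⟩
  · rw [hy, Finsupp.finsetSum_apply]
    refine Finset.sum_nonneg fun a ha => ?_
    rw [Finset.mem_Ico] at ha
    rw [Finsupp.single_apply]
    split_ifs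
    exacts [sub_nonneg.2 (hanti a ha.1 ha.2), le_rfl]
  · have h1 : (y.sum fun _ r => r) = weight Set.univ y := by
      rw [weight_apply]
      simp [Finsupp.sum]
    rw [h1, hy, map_sum]
    simp only [weight_single, Set.mem_univ, if_true]
    rw [htel b le_rfl hbe.le, htb]
  · refine IsChain.mono hsupp ?_
    rintro _ ⟨i, hi, rfl⟩ _ ⟨j, hj, rfl⟩ -
    rcases le_total i j with h | h
    · exact Or.inl (hq.monotoneOn hi hj h)
    · exact Or.inr (hq.monotoneOn hj hi h)
  · intro W hW hbot htop
    -- The least such index starts the final segment cut out by `W`; it exceeds `b` because `⊥ ∉ W`.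
    have hex : ∃ j, b ≤ j ∧ q j ∈ W := ⟨e - 1, by omega, hqe ▸ htop⟩
    set j := Nat.find hex with hj
    obtain ⟨hbj, hjW⟩ := Nat.find_spec hex
    have hje : j ≤ e - 1 := Nat.find_min' hex ⟨by omega, hqe ▸ htop⟩
    have hbj' : b < j := lt_of_le_of_ne hbj fun h => hbot (hqb ▸ h ▸ hjW)
    have hmem : ∀ a ∈ Finset.Ico b e, (q a ∈ W ↔ j ≤ a) := by
      intro a ha
      rw [Finset.mem_Ico] at ha
      refine ⟨fun h => Nat.find_min' hex ⟨ha.1, h⟩, fun h => hW (hq.monotoneOn ?_ ?_ h) hjW⟩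
      · exact ⟨hbj, by omega⟩
      · exact ha
    have hwt : ∀ f : ℕ → ℝ, weight W (∑ a ∈ Finset.Ico b e, Finsupp.single (q a) (f a)) =
        ∑ a ∈ Finset.Ico j e, f a := by
      intro f
      rw [map_sum]
      simp only [weight_single]
      rw [← Finset.sum_filter]
      refine Finset.sum_congr ?_ fun _ _ => rfl
      ext a
      rw [Finset.mem_filter]
      constructor
      · rintro ⟨h1, h2⟩
        rw [hmem a h1] at h2
        simp at h1 ⊢
        omega
      · intro h
        rw [Finset.mem_Ico] at h
        have h1 : a ∈ Finset.Ico b e := Finset.mem_Ico.2 ⟨by omega, h.2⟩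
        exact ⟨h1, (hmem a h1).2 h.1⟩
    change weight W y = T (weight W x.1)
    rw [hy, hwt, hx, hwt, htel j hbj (by omega), ht, tailMass, if_neg (by omega),
      if_pos (by omega)]

lemma exists_isClip_of_isMaxChainSeq {T : ℝ → ℝ} (hT : Monotone T) (hT0 : ∀ r, 0 ≤ T r)
    (hT1 : ∀ r, T r ≤ 1) {x : K L} {n : ℕ} {p : Fin (n + 1) → L} (hp : IsMaxChainSeq p)
    (hx : x.supp ⊆ Set.range p) : ∃ y, IsClip T x y := by
  set q : ℕ → L := fun a => if h : a < n + 1 then p ⟨a, h⟩ else ⊥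
  have hqp : ∀ i : Fin (n + 1), q i = p i := fun i => dif_pos i.2
  have hmono : StrictMonoOn q (Set.Ico 0 (n + 1)) := by
    intro a ha b hb hab
    have := hp.1 (show (⟨a, ha.2⟩ : Fin (n + 1)) < ⟨b, hb.2⟩ from hab)
    rwa [← hqp, ← hqp] at this
  have hsum : x.1 = ∑ a ∈ Finset.Ico 0 (n + 1), Finsupp.single (q a) (x.coeff (q a)) := by
    rw [← Finset.range_eq_Ico, Finset.sum_range]
    simp only [hqp]
    exact K.eq_sum_single hp.1.injective hx
  obtain ⟨y, -, hy⟩ := exists_isClip_of_chain hT hT0 hT1 (Nat.succ_pos n) hmono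
    ((hqp 0).trans hp.apply_zero) ((hqp (Fin.last n)).trans hp.apply_last) hsum
  exact ⟨y, hy⟩

end Clip

/-! ### Jump coordinates and the length metrics -/

section Distance

variable {L : Type u} [Lattice L]

lemma supp_vertex (p : L) : (K.vertex p).supp = {p} := by
  ext q
  simp [K.supp, K.vertex, eq_comm]

variable [BoundedOrder L]

/-- The masses of the jump sets of the chain `c`. -/
noncomputable def jumpCoord {n : ℕ} (c : Fin (n + 1) → L) (x : K L) : Fin n → ℝ :=
  fun i => x.mass (jumpSet c i)

lemma jumpCoord_vertex_bot {n : ℕ} (c : Fin (n + 1) → L) : jumpCoord c (K.vertex ⊥) = 0 := by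
  classical
  ext i
  rw [jumpCoord, K.mass, K.vertex, weight_single, if_neg (bot_notMem_jumpSet c i)]
  rfl

lemma IsClip.jumpCoord_eq {T : ℝ → ℝ} {x y : K L} (h : IsClip T x y) {n : ℕ}
    {c : Fin (n + 1) → L} (hc : StrictMono c) (i : Fin n) :
    jumpCoord c y i = T (jumpCoord c x i) :=
  h _ (isUpperSet_jumpSet c i) (bot_notMem_jumpSet c i) (top_mem_jumpSet hc i)

/-- The jump coordinates map every maximal simplex isometrically. -/
lemma simplexDist_eq [IsModularLattice L] (q : ENNReal) [Fact (1 ≤ q)] {n m : ℕ}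
    {c : Fin (n + 1) → L} {p : Fin (m + 1) → L} (hc : IsMaxChainSeq c) (hp : IsMaxChainSeq p)
    {x y : K L} (hx : x.supp ⊆ Set.range p) (hy : y.supp ⊆ Set.range p) :
    simplexDist q p x y = ‖WithLp.toLp q (jumpCoord c x - jumpCoord c y)‖ := by
  classical
  obtain ⟨σ, hσ⟩ := exists_jump_order hc hp
  -- By the choice of `σ`, `p j` jumps at `σ i` exactly when the `j`-th orthoscheme vertex has
  -- `i`-th entry `1`.
  have key : ∀ {z : K L}, z.supp ⊆ Set.range p → ∀ i, phi p z i = jumpCoord c z (σ i) := by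
    intro z hz i
    rw [jumpCoord, K.mass_eq_sum_range hp.1.injective hz, phi, Finset.sum_apply]
    refine Finset.sum_congr rfl fun j _ => ?_
    simp [orthoVertex, hσ]
  rw [simplexDist, ← (LinearIsometryEquiv.piLpCongrLeft q ℝ ℝ σ).norm_map]
  congr 1
  ext k
  obtain ⟨i, rfl⟩ := σ.surjective k
  simp [LinearIsometryEquiv.piLpCongrLeft_apply, Equiv.piCongrLeft', key hx, key hy]

lemma norm_jumpCoord_sub_le_of_isStringLength [IsModularLattice L] (q : ENNReal)
    [Fact (1 ≤ q)] {n : ℕ} {c : Fin (n + 1) → L} (hc : IsMaxChainSeq c) {x y : K L} {l : ℝ}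
    (h : IsStringLength q x y l) : ‖WithLp.toLp q (jumpCoord c x - jumpCoord c y)‖ ≤ l := by
  induction h with
  | nil x => simp
  | cons p hp x y z l hx hy _ ih =>
    rw [simplexDist_eq q hc hp hx hy, ← sub_add_sub_cancel (jumpCoord c x) (jumpCoord c y),
      WithLp.toLp_add]
    exact (norm_add_le _ _).trans (add_le_add_right ih _)

lemma exists_isMaxChainSeq_supp_subset [IsModularLattice L] {n : ℕ}
    (hn : Order.height (⊤ : L) = n) (x : K L) :
    ∃ p : Fin (n + 1) → L, IsMaxChainSeq p ∧ x.supp ⊆ Set.range p := by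
  obtain ⟨M, hM, hx⟩ := x.isChain_supp.exists_maxChain
  obtain ⟨p, hp, rfl⟩ := exists_isMaxChainSeq hn hM
  exact ⟨p, hp, hx⟩

lemma supp_vertex_bot_subset {m : ℕ} {p : Fin (m + 1) → L} (hp : IsMaxChainSeq p) :
    (K.vertex (⊥ : L)).supp ⊆ Set.range p := by
  rw [supp_vertex, Set.singleton_subset_iff]
  exact hp.2.bot_mem

lemma norm_jumpCoord_sub_le_pathDist [IsModularLattice L] {n : ℕ}
    (hn : Order.height (⊤ : L) = n) (q : ENNReal) [Fact (1 ≤ q)] {c : Fin (n + 1) → L}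
    (hc : IsMaxChainSeq c) (x y : K L) :
    ‖WithLp.toLp q (jumpCoord c x - jumpCoord c y)‖ ≤ pathDist q x y := by
  refine le_csInf ?_ fun l hl => norm_jumpCoord_sub_le_of_isStringLength q hc hl
  -- The infimum is over a nonempty set: any two points are joined by a string through the vertex
  -- `⊥`.
  obtain ⟨p, hp, hx⟩ := exists_isMaxChainSeq_supp_subset hn x
  obtain ⟨r, hr, hy⟩ := exists_isMaxChainSeq_supp_subset hn y
  exact ⟨_, .cons p hp x _ y _ hx (supp_vertex_bot_subset hp)
    (.cons r hr _ y y _ (supp_vertex_bot_subset hr) hy (.nil y))⟩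

/-- A single segment attains the lower bound, whichever chain `c` supplies the coordinates. -/
lemma pathDist_eq_norm [IsModularLattice L] {n : ℕ} (hn : Order.height (⊤ : L) = n)
    (q : ENNReal) [Fact (1 ≤ q)] {c p : Fin (n + 1) → L} (hc : IsMaxChainSeq c)
    (hp : IsMaxChainSeq p) {x y : K L} (hx : x.supp ⊆ Set.range p) (hy : y.supp ⊆ Set.range p) :
    pathDist q x y = ‖WithLp.toLp q (jumpCoord c x - jumpCoord c y)‖ := by
  refine le_antisymm (csInf_le ⟨0, fun l hl => ?_⟩ ?_) (norm_jumpCoord_sub_le_pathDist hn q hc x y)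
  · exact (norm_nonneg _).trans (norm_jumpCoord_sub_le_of_isStringLength q hc hl)
  · rw [← simplexDist_eq q hc hp hx hy, ← add_zero (simplexDist q p x y)]
    exact .cons p hp x y y 0 hx hy (.nil y)

lemma pathDist_bot_eq_norm [IsModularLattice L] {n : ℕ} (hn : Order.height (⊤ : L) = n)
    (q : ENNReal) [Fact (1 ≤ q)] {c : Fin (n + 1) → L} (hc : IsMaxChainSeq c) (y : K L) :
    pathDist q (K.vertex ⊥) y = ‖WithLp.toLp q (jumpCoord c y)‖ := by
  obtain ⟨p, hp, hy⟩ := exists_isMaxChainSeq_supp_subset hn y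
  rw [pathDist_eq_norm hn q hc hp (supp_vertex_bot_subset hp) hy, jumpCoord_vertex_bot, zero_sub,
    WithLp.toLp_neg, norm_neg]

lemma d1_bot_eq_sum [IsModularLattice L] {n : ℕ} (hn : Order.height (⊤ : L) = n)
    {c : Fin (n + 1) → L} (hc : IsMaxChainSeq c) (y : K L) :
    d1 (K.vertex ⊥) y = ∑ i, jumpCoord c y i := by
  rw [d1, pathDist_bot_eq_norm hn 1 hc, PiLp.norm_eq_of_L1]
  exact Finset.sum_congr rfl fun i _ => abs_of_nonneg (y.mass_nonneg _)

lemma d_bot_sq_eq_sum [IsModularLattice L] {n : ℕ} (hn : Order.height (⊤ : L) = n)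
    {c : Fin (n + 1) → L} (hc : IsMaxChainSeq c) (y : K L) :
    d (K.vertex ⊥) y ^ 2 = ∑ i, jumpCoord c y i ^ 2 := by
  rw [d, pathDist_bot_eq_norm hn 2 hc, PiLp.norm_sq_eq_of_L2]
  simp

lemma sum_sq_le_d_sq [IsModularLattice L] {n : ℕ} (hn : Order.height (⊤ : L) = n)
    {c : Fin (n + 1) → L} (hc : IsMaxChainSeq c) (x y : K L) :
    ∑ i, (jumpCoord c x i - jumpCoord c y i) ^ 2 ≤ d x y ^ 2 := by
  have h := pow_le_pow_left₀ (norm_nonneg _) (norm_jumpCoord_sub_le_pathDist hn 2 hc x y) 2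
  rw [PiLp.norm_sq_eq_of_L2] at h
  simpa [d] using h

lemma d_sq_eq_sum [IsModularLattice L] {n : ℕ} (hn : Order.height (⊤ : L) = n)
    {c p : Fin (n + 1) → L} (hc : IsMaxChainSeq c) (hp : IsMaxChainSeq p) {x y : K L}
    (hx : x.supp ⊆ Set.range p) (hy : y.supp ⊆ Set.range p) :
    d x y ^ 2 = ∑ i, (jumpCoord c x i - jumpCoord c y i) ^ 2 := by
  rw [d, pathDist_eq_norm hn 2 hc hp hx hy, PiLp.norm_sq_eq_of_L2]
  simp

/-- On the simplex of the chain `c` the jump coordinates determine a point, even among all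
points of the complex. -/
lemma eq_of_jumpCoord_eq {n : ℕ} {c : Fin (n + 1) → L} (hc : IsMaxChainSeq c) {y z : K L}
    (hz : z.supp ⊆ Set.range c) (h : jumpCoord c y = jumpCoord c z) : y = z := by
  have hanti : ∀ i j, i ≤ j → z.mass (jumpSet c j) ≤ z.mass (jumpSet c i) := by
    intro i j hij
    refine K.mass_mono ?_
    rintro _ ⟨hp, hj⟩
    obtain ⟨l, rfl⟩ := hz hp
    rw [apply_mem_jumpSet hc.1] at hj ⊢
    exact (Fin.castSucc_le_castSucc_iff.2 hij).trans_lt hj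
  -- If `p` jumps at `j` but not at `i`, every support element that jumps at `i` lies above `p` and
  -- so jumps at `j`. Then coordinate `j` of `y` exceeds coordinate `i`, against `hanti`.
  have hinit : ∀ p ∈ y.supp, ∀ i j, i ≤ j → p ∈ jumpSet c j → p ∈ jumpSet c i := by
    intro p hp i j hij hj
    by_contra hi
    have h1 : y.mass (jumpSet c i) < y.mass (jumpSet c j) := by
      refine K.mass_lt_mass ?_ hp hi hj
      rintro r ⟨hr, hri⟩
      refine isUpperSet_jumpSet c j ?_ hj
      exact (y.isChain_supp.total hr hp).resolve_left fun h2 =>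
        hi (isUpperSet_jumpSet c i h2 hri)
    have h2 := hanti i j hij
    have hi' := congrFun h i
    have hj' := congrFun h j
    simp only [jumpCoord] at hi' hj'
    linarith
  -- Let `c i.castSucc ≤ p` be the last chain element reached before the chain leaves the elements
  -- below `p`. There is no jump at `i`, hence none later, and at `⊤` this says `p = c i.castSucc`.
  have hy : y.supp ⊆ Set.range c := by
    intro p hp
    by_contra hpc
    obtain ⟨i, hi1, hi2⟩ := exists_castSucc_succ (P := fun j => c j ≤ p)
      (by simp [hc.apply_zero])
      (by
        rw [hc.apply_last, top_le_iff]
        rintro rfl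
        exact hpc hc.2.top_mem)
    have hi : p ∉ jumpSet c i := by
      rw [mem_jumpSet, not_not, inf_eq_right.2 hi1]
      refine ((hc.covBy i).eq_or_eq (le_inf hi1 (hc.covBy i).le) inf_le_right).elim Eq.symm
        fun h3 => (hi2 (inf_eq_right.1 h3)).elim
    have hj : ∀ j, i.castSucc ≤ j → p ⊓ c j = c i.castSucc := by
      refine fun j => Fin.induction (fun h0 => ?_) (fun j ih hij => ?_) j
      · rw [le_antisymm h0 (Fin.zero_le _)] at hi1 ⊢
        exact inf_eq_right.2 hi1
      · rcases hij.eq_or_lt with h3 | h3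
        · rw [← h3]
          exact inf_eq_right.2 hi1
        · have h4 : i.castSucc ≤ j.castSucc := Fin.le_castSucc_iff.2 h3
          rw [← ih h4]
          by_contra h5
          exact hi (hinit p hp i j (Fin.castSucc_le_castSucc_iff.1 h4) (Ne.symm h5))
    have h3 := hj (Fin.last n) (Fin.le_last _)
    rw [hc.apply_last, inf_top_eq] at h3
    exact hpc ⟨_, h3.symm⟩
  refine K.ext_mass fun W hW hbot htop => ?_
  obtain ⟨i, hi1, hi2⟩ := exists_castSucc_succ (P := fun j => c j ∉ W)
    (by rwa [hc.apply_zero]) (by rwa [hc.apply_last, not_not])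
  rw [not_not] at hi2
  -- On the chain, `W` and the `i`-th jump set both consist of the elements from `c i.succ` upwards.
  have key : ∀ {w : K L}, w.supp ⊆ Set.range c → w.mass W = jumpCoord c w i := by
    intro w hw
    refine K.mass_congr fun p hp => ?_
    obtain ⟨j, rfl⟩ := hw hp
    rw [apply_mem_jumpSet hc.1]
    refine ⟨fun hj => ?_, fun hj => hW (hc.1.monotone (Fin.castSucc_lt_iff_succ_le.1 hj)) hi2⟩
    by_contra hji
    exact hi1 (hW (hc.1.monotone (not_lt.1 hji)) hj)
  rw [key hy, key hz, h]

end Distance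

/-! ### Coordinatewise minimization and the resolvent -/

section Resolvent

/-- The coordinatewise form of the resolvent. -/
noncomputable def clip (C ε lam r : ℝ) : ℝ := max 0 (min 1 ((r + lam * C) / (1 + 2 * ε * lam)))

lemma clip_monotone {C ε lam : ℝ} (hε : 0 ≤ ε) (hlam : 0 < lam) : Monotone (clip C ε lam) := by
  intro r s h
  unfold clip
  gcongr

lemma clip_nonneg (C ε lam r : ℝ) : 0 ≤ clip C ε lam r := le_max_left _ _

lemma clip_le_one (C ε lam r : ℝ) : clip C ε lam r ≤ 1 :=
  max_le zero_le_one (min_le_left _ _)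

/-- The obtuse angle property of the projection of `z` to `[0,1]`. -/
lemma sq_sub_clip_le (z : ℝ) {t : ℝ} (h0 : 0 ≤ t) (h1 : t ≤ 1) :
    (t - max 0 (min 1 z)) ^ 2 ≤ (t - z) ^ 2 - (max 0 (min 1 z) - z) ^ 2 := by
  rcases le_total z 0 with h | h
  · rw [min_eq_right (by linarith), max_eq_left h]
    nlinarith
  · rcases le_total z 1 with h' | h'
    · rw [min_eq_right h', max_eq_right h]
      simp
    · rw [min_eq_left h', max_eq_right zero_le_one]
      nlinarith

/-- Completing the square puts the unconstrained minimum at `(r + lam * C) / D` with `D = 1 + 2 * ε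
* lam`, which is then projected to `[0,1]`. The extra square on the left comes from `D ≥ 1` and
yields uniqueness. -/
lemma clip_minimizes (C : ℝ) {ε lam : ℝ} (hε : 0 ≤ ε) (hlam : 0 < lam) (r : ℝ) {t : ℝ}
    (h0 : 0 ≤ t) (h1 : t ≤ 1) :
    -C * clip C ε lam r + ε * clip C ε lam r ^ 2 + 1 / (2 * lam) * (r - clip C ε lam r) ^ 2 +
      1 / (2 * lam) * (t - clip C ε lam r) ^ 2 ≤
    -C * t + ε * t ^ 2 + 1 / (2 * lam) * (r - t) ^ 2 := by
  have hD : 1 ≤ 1 + 2 * ε * lam := by nlinarith [mul_nonneg hε hlam.le]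
  set D := 1 + 2 * ε * lam with hDdef
  have h := sq_sub_clip_le ((r + lam * C) / D) h0 h1
  rw [show max 0 (min 1 ((r + lam * C) / D)) = clip C ε lam r from rfl] at h
  set s := clip C ε lam r
  have hz : (r + lam * C) / D * D = r + lam * C := div_mul_cancel₀ _ (by positivity)
  set z := (r + lam * C) / D
  have h2 : (t - s) ^ 2 ≤ D * ((t - z) ^ 2 - (s - z) ^ 2) :=
    h.trans (le_mul_of_one_le_left ((sq_nonneg _).trans h) hD)
  have key : ∀ u : ℝ, -C * u + ε * u ^ 2 + 1 / (2 * lam) * (r - u) ^ 2 =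
      1 / (2 * lam) * (D * u ^ 2 - 2 * (z * D) * u + r ^ 2) := by
    intro u
    rw [hz, hDdef]
    field_simp
    ring
  rw [key, key, ← mul_add]
  refine mul_le_mul_of_nonneg_left ?_ (by positivity)
  linarith

variable {L : Type u} [Lattice L] [BoundedOrder L]

lemma objective_add_eq_sum [IsModularLattice L] {n : ℕ} (hn : Order.height (⊤ : L) = n)
    {c : Fin (n + 1) → L} (hc : IsMaxChainSeq c) (C ε : ℝ) (y : K L) (w : ℝ) (v : Fin n → ℝ) :
    objective C ε y + w * ∑ i, v i =
      ∑ i, (-C * jumpCoord c y i + ε * jumpCoord c y i ^ 2 + w * v i) := by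
  rw [objective, d1_bot_eq_sum hn hc, d_bot_sq_eq_sum hn hc]
  simp only [Finset.mul_sum, Finset.sum_add_distrib]

lemma proxSet_objective_eq [IsModularLattice L] {n : ℕ} (hn : Order.height (⊤ : L) = n)
    {C ε lam : ℝ} (hε : 0 ≤ ε) (hlam : 0 < lam) {x z : K L} (hz : IsClip (clip C ε lam) x z) :
    proxSet (objective C ε) lam x = {z} := by
  obtain ⟨c, hc, hx⟩ := exists_isMaxChainSeq_supp_subset hn x
  have hzc : z.supp ⊆ Set.range c := hz.supp_subset.trans
    (Set.insert_subset hc.2.bot_mem (Set.insert_subset hc.2.top_mem hx))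
  have hw : 0 < 1 / (2 * lam) := by positivity
  have key : ∀ y, objective C ε z + 1 / (2 * lam) * d x z ^ 2 +
      1 / (2 * lam) * ∑ i, (jumpCoord c y i - jumpCoord c z i) ^ 2 ≤
      objective C ε y + 1 / (2 * lam) * d x y ^ 2 := by
    intro y
    -- For general `y` the coordinates only bound `d x y` from below; for `z`, in the simplex of `c`
    -- with `x`, they give the exact distance.
    refine le_trans ?_ (add_le_add_right
      (mul_le_mul_of_nonneg_left (sum_sq_le_d_sq hn hc x y) hw.le) _)
    rw [d_sq_eq_sum hn hc hc hx hzc, objective_add_eq_sum hn hc, objective_add_eq_sum hn hc,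
      Finset.mul_sum, ← Finset.sum_add_distrib]
    refine Finset.sum_le_sum fun i _ => ?_
    rw [hz.jumpCoord_eq hc.1]
    exact clip_minimizes C hε hlam _ (y.mass_nonneg _) (y.mass_le_one _)
  ext y
  rw [Set.mem_singleton_iff]
  constructor
  · intro hy
    have h1 : ∑ i, (jumpCoord c y i - jumpCoord c z i) ^ 2 ≤ 0 := by
      have h2 := (key y).trans (hy z)
      by_contra! h3
      linarith [mul_pos hw h3]
    refine eq_of_jumpCoord_eq hc hzc (funext fun i => ?_)
    have h2 := (Finset.sum_eq_zero_iff_of_nonneg fun i _ => sq_nonneg _).1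
      (h1.antisymm (Finset.sum_nonneg fun i _ => sq_nonneg _)) i (Finset.mem_univ i)
    exact sub_eq_zero.1 (pow_eq_zero_iff two_ne_zero |>.1 h2)
  · intro hyz w
    rw [hyz]
    refine le_trans ?_ (key w)
    have : 0 ≤ ∑ i, (jumpCoord c w i - jumpCoord c z i) ^ 2 :=
      Finset.sum_nonneg fun i _ => sq_nonneg _
    linarith [mul_nonneg hw.le this]

/-- By independence of the base, `i ∈ S` means that `a i` lies below the join of `S`. The coordinate
thus becomes the mass of an upper set, to which `IsClip` applies. -/
lemma frameCoord_eq_mass [IsModularLattice L] {n : ℕ} (hn : Order.height (⊤ : L) = n)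
    {a : Fin n → L} (ha : IsBase a) {x : K L} (hx : x.supp ⊆ frame a) (i : Fin n) :
    frameCoord a x i = x.mass (Set.Ici (a i)) := by
  classical
  rw [K.mass_eq_sum_range (ha.sup_injective hn) hx, frameCoord]
  refine Finset.sum_congr rfl fun S _ => ?_
  simp [ha.le_sup_iff hn]

lemma IsClip.frameCoord_eq [IsModularLattice L] {n : ℕ} (hn : Order.height (⊤ : L) = n)
    {T : ℝ → ℝ} {x y : K L} (h : IsClip T x y) {a : Fin n → L} (ha : IsBase a)
    (hx : x.supp ⊆ frame a) :
    y.supp ⊆ frame a ∧ ∀ i, frameCoord a y i = T (frameCoord a x i) := by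
  have hy : y.supp ⊆ frame a := h.supp_subset.trans
    (Set.insert_subset (bot_mem_frame a) (Set.insert_subset ha.top_mem_frame hx))
  refine ⟨hy, fun i => ?_⟩
  rw [frameCoord_eq_mass hn ha hx, frameCoord_eq_mass hn ha hy]
  exact h _ (isUpperSet_Ici _) (by simpa using (ha.1 i).1) le_top

end Resolvent

/-! ### Reasoning about machine runs -/

section Execution

variable {L : Type u} [Lattice L] [BoundedOrder L]

/-- From `s`, the program `P` reaches a configuration with property `Q` within `T` steps, and all
numbers that are in the memory up to then belong to `G`. -/
def Leads (P : Program) (G : Set ℝ) (T : ℕ) (Q : Config L → Prop) (s : Config L) : Prop :=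
  ∃ t ≤ T, Q (P.run t s) ∧ ∀ u ≤ t, ∀ a, (P.run u s).num a ∈ G

variable {P : Program} {G : Set ℝ} {T : ℕ} {Q : Config L → Prop} {s s' : Config L}

lemma Leads.done (hs : ∀ a, s.num a ∈ G) (h : Q s) : Leads P G T Q s :=
  ⟨0, Nat.zero_le _, h, fun u hu => by rwa [Nat.le_zero.1 hu]⟩

lemma Leads.mono {T' : ℕ} (h : Leads P G T Q s) (hT : T ≤ T') : Leads P G T' Q s :=
  let ⟨t, ht, h'⟩ := h
  ⟨t, ht.trans hT, h'⟩

lemma Leads.step (i : Instr) (hi : P[s.pc]? = some i) (hs : ∀ a, s.num a ∈ G)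
    (he : i.exec s = s') (h : Leads P G T Q s') : Leads P G (T + 1) Q s := by
  have h1 : ∀ t, P.run (t + 1) s = P.run t s' := fun t => by
    rw [Program.run, Function.iterate_succ_apply, Program.step, hi, ← he]
    rfl
  obtain ⟨t, ht, hQ, hG⟩ := h
  refine ⟨t + 1, Nat.succ_le_succ ht, by rwa [h1], fun u hu => ?_⟩
  rcases u with _ | u
  · exact hs
  · rw [h1]
    exact hG u (Nat.le_of_succ_le_succ hu)

lemma Program.run_of_halted (hs : P.Halted s) (t : ℕ) : P.run t s = s := by
  refine Function.iterate_fixed ?_ t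
  rw [Program.step, List.getElem?_eq_none hs]

/-- A halted configuration never changes, so control up to halting is control for all time. -/
lemma Leads.num_mem (h : Leads P G T Q s) (hQ : ∀ s', Q s' → P.Halted s') (t a : ℕ) :
    (P.run t s).num a ∈ G := by
  obtain ⟨t', -, h1, h2⟩ := h
  rcases le_total t t' with h3 | h3
  · exact h2 t h3 a
  · obtain ⟨d, rfl⟩ := Nat.exists_eq_add_of_le h3
    have : P.run (t' + d) s = P.run t' s := by
      rw [Nat.add_comm, Program.run, Function.iterate_add_apply]
      exact Program.run_of_halted (hQ _ h1) d
    rw [this]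
    exact h2 t' le_rfl a

lemma update_mem {N : ℕ → ℝ} (hN : ∀ a, N a ∈ G) (i : ℕ) {v : ℝ} (hv : v ∈ G) (a : ℕ) :
    Function.update N i v a ∈ G := by
  rw [Function.update_apply]
  split_ifs
  exacts [hv, hN a]

end Execution

/-! ### The program and its main loop -/

section Program

/-- The program that computes the resolvent.  It first stores `lam * C` in `N[0]`,
`1 + 2 * ε * lam` in `N[1]` and `1` in `N[2]`, then adds the greatest and the least element to the
chain if they are missing, and then runs through the chain from above. -/
def resolventProgram : Program :=
  [.idxConst 3 1, .idxConst 4 2, .numMul 2 4 2, .numMul 3 3 4, .numAdd 3 3 3, .numOne 4,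
    .numAdd 3 3 4, .idxConst 1 3, .idxAdd 5 0 1, .idxAdd 6 5 4, .idxAdd 7 6 3, .idxAdd 8 7 3,
    .eltTop 5, .idxSub 9 5 3, .jumpElt 5 9 17, .idxAdd 0 0 3, .idxAdd 5 5 3,
    .eltBot 4, .jumpElt 1 4 21, .idxAdd 0 0 3, .idxConst 1 2,
    .idxSub 5 5 3, .jumpIdx 5 1 31, .numAdd 6 6 5, .numAdd 7 6 2, .numDiv 7 7 3,
    .jumpNum 7 4 28, .numCopy 7 4, .numSub 5 7 8, .numCopy 8 7, .jumpIdx 2 2 21,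
    .numSub 1 4 8]

variable {L : Type u} [Lattice L] [BoundedOrder L]

/-- The contents of the index registers that stay fixed in the main loop. -/
structure Registers (k b e : ℕ) (I : ℕ → ℕ) : Prop where
  idx0 : I 0 = e - b
  idx1 : I 1 = b
  idx2 : I 2 = 0
  idx3 : I 3 = 1
  idx4 : I 4 = 2
  idx6 : I 6 = k + 5
  idx7 : I 7 = k + 6
  idx8 : I 8 = k + 7

lemma Registers.update {k b e : ℕ} {I : ℕ → ℕ} (h : Registers k b e I) (j : ℕ) :
    Registers k b e (Function.update I 5 j) := by
  constructor <;> simp [h.idx0, h.idx1, h.idx2, h.idx3, h.idx4, h.idx6, h.idx7, h.idx8]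

variable {G : Set ℝ} {T : ℕ} {Q : Config L → Prop}

/-- Cell `k + 5` accumulates the tail sum, `k + 6` receives the new clipped tail and `k + 7` keeps
the previous one. Cell `i` is read before the difference overwrites it, so the output is produced in
place. -/
lemma leads_loopBody {k b e i : ℕ} {A D u v : ℝ} {I : ℕ → ℕ} {N : ℕ → ℝ} {E : ℕ → L}
    (hI : Registers k b e I) (hI5 : I 5 = i) (hi : i ≤ k + 4) (hN0 : N 0 = A)
    (hN1 : N 1 = D) (hN2 : N 2 = 1) (hu : N (k + 5) + N i = u) (hv : v = min 1 ((u + A) / D))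
    (hN : ∀ a, N a ∈ G) (h1 : 1 ∈ G) (hG1 : u ∈ G) (hG2 : u + A ∈ G) (hG3 : (u + A) / D ∈ G)
    (hG4 : v - N (k + 7) ∈ G)
    (h : Leads resolventProgram G T Q
      ⟨21, I, Function.update (Function.update (Function.update (Function.update N
        (k + 5) u) (k + 6) v) i (v - N (k + 7))) (k + 7) v, E⟩) :
    Leads resolventProgram G (T + 8) Q ⟨23, I, N, E⟩ := by
  have hvG : v ∈ G := by
    rw [hv]
    rcases min_choice 1 ((u + A) / D) with h2 | h2 <;> rw [h2] <;> assumption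
  have n1 : i ≠ k + 5 := by omega
  have n2 : i ≠ k + 6 := by omega
  have n3 : i ≠ k + 7 := by omega
  have hNu := update_mem hN (k + 5) hG1
  have hNv := update_mem hNu (k + 6) hvG
  refine Leads.step (.numAdd 6 6 5) rfl hN
    (s' := ⟨24, I, Function.update N (k + 5) u, E⟩) ?_ ?_
  · simp [Instr.exec, Config.setNum, Config.getNum, hI.idx6, hI5, hu]
  refine Leads.step (.numAdd 7 6 2) rfl hNu
    (s' := ⟨25, I, Function.update (Function.update N (k + 5) u) (k + 6) (u + A), E⟩) ?_ ?_
  · simp [Instr.exec, Config.setNum, Config.getNum, hI.idx6, hI.idx7, hI.idx2, hN0]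
  refine Leads.step (.numDiv 7 7 3) rfl (update_mem hNu _ hG2)
    (s' := ⟨26, I, Function.update (Function.update N (k + 5) u) (k + 6) ((u + A) / D), E⟩) ?_ ?_
  · simp [Instr.exec, Config.setNum, Config.getNum, hI.idx7, hI.idx3, hN1]
  have tail : Leads resolventProgram G (T + 3) Q
      ⟨28, I, Function.update (Function.update N (k + 5) u) (k + 6) v, E⟩ := by
    refine Leads.step (.numSub 5 7 8) rfl hNv (s' := ⟨29, I, Function.update (Function.update
      (Function.update N (k + 5) u) (k + 6) v) i (v - N (k + 7)), E⟩) ?_ ?_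
    · simp [Instr.exec, Config.setNum, Config.getNum, hI.idx7, hI.idx8, hI5]
    refine Leads.step (.numCopy 8 7) rfl (update_mem hNv _ hG4) (s' := ⟨30, I, Function.update
      (Function.update (Function.update (Function.update N (k + 5) u) (k + 6) v)
        i (v - N (k + 7))) (k + 7) v, E⟩) ?_ ?_
    · simp [Instr.exec, Config.setNum, Config.getNum, hI.idx7, hI.idx8, n2.symm]
    -- Comparing a register with itself gives an unconditional jump.
    refine Leads.step (.jumpIdx 2 2 21) rfl (update_mem (update_mem hNv _ hG4) _ hvG) ?_ h
    simp [Instr.exec, Config.jumpIf]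
  by_cases hle : (u + A) / D ≤ 1
  · rw [min_eq_right hle] at hv
    rw [hv] at tail
    refine Leads.step (.jumpNum 7 4 28) rfl (update_mem hNu _ hG3) ?_ (tail.mono (by omega))
    simp [Instr.exec, Config.jumpIf, Config.getNum, hI.idx7, hI.idx4, hN2, hle]
  · rw [min_eq_left (not_le.1 hle).le] at hv
    refine Leads.step (.jumpNum 7 4 28) rfl (update_mem hNu _ hG3) (s' := ⟨27, I,
      Function.update (Function.update N (k + 5) u) (k + 6) ((u + A) / D), E⟩) ?_ ?_
    · simp [Instr.exec, Config.jumpIf, Config.getNum, hI.idx7, hI.idx4, hN2, hle]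
    refine Leads.step (.numCopy 7 4) rfl (update_mem hNu _ hG3) ?_ tail
    simp [Instr.exec, Config.setNum, Config.getNum, hI.idx7, hI.idx4, hN2, hv]

/-- The set `G` contains all numbers that the main loop computes. -/
structure LoopClosed (G : Set ℝ) (F : ℝ → ℝ) (A D : ℝ) (c : ℕ → ℝ) (b e : ℕ) : Prop where
  one : 1 ∈ G
  sum : ∀ i, ∑ l ∈ Finset.Ico i e, c l ∈ G
  sum_add : ∀ i, ∑ l ∈ Finset.Ico i e, c l + A ∈ G
  div : ∀ i, (∑ l ∈ Finset.Ico i e, c l + A) / D ∈ G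
  sub : ∀ i, tailMass F c b e i - tailMass F c b e (i + 1) ∈ G

/-- The final configurations of the program. -/
def IsFinal (F : ℝ → ℝ) (c : ℕ → ℝ) (q : ℕ → L) (b e : ℕ) (s : Config L) : Prop :=
  resolventProgram.Halted s ∧ s.idx 0 = e - b ∧ s.idx 1 = b ∧
    ∀ i, b ≤ i → i < e → s.elt i = q i ∧
      s.num i = tailMass F c b e i - tailMass F c b e (i + 1)

/-- Invariant: cells from `j` on are final, those strictly between `b` and `j` still hold the input,
and the scratch cells hold the plain and the clipped tail from `j`. The bounds on `b` and `e` keep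
the pass off the constants and the scratch cells. A pass costs two steps for the loop head and eight
for the body. -/
lemma leads_loop {k b e : ℕ} {F : ℝ → ℝ} {A D : ℝ} {c : ℕ → ℝ} {q E : ℕ → L} (hb : 2 ≤ b)
    (he : e ≤ k + 4) (hG : LoopClosed G F A D c b e)
    (hF : ∀ i, F (∑ l ∈ Finset.Ico i e, c l) = min 1 ((∑ l ∈ Finset.Ico i e, c l + A) / D))
    (hE : ∀ i, b ≤ i → i < e → E i = q i) (j : ℕ) (hbj : b < j) (hje : j ≤ e)
    {I : ℕ → ℕ} {N : ℕ → ℝ} (hI : Registers k b e I) (hI5 : I 5 = j) (hN : ∀ a, N a ∈ G)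
    (hN0 : N 0 = A) (hN1 : N 1 = D) (hN2 : N 2 = 1)
    (hNu : N (k + 5) = ∑ l ∈ Finset.Ico j e, c l) (hNt : N (k + 7) = tailMass F c b e j)
    (hNlow : ∀ i, b < i → i < j → N i = c i)
    (hNhigh : ∀ i, j ≤ i → i < e → N i = tailMass F c b e i - tailMass F c b e (i + 1)) :
    Leads resolventProgram G (10 * (j - b)) (IsFinal F c q b e) ⟨21, I, N, E⟩ := by
  induction j, hbj using Nat.le_induction generalizing I N with
  | base =>
    refine Leads.mono (T := 3) ?_ (by omega)
    refine Leads.step (.idxSub 5 5 3) rfl hN (s' := ⟨22, Function.update I 5 b, N, E⟩) ?_ ?_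
    · simp [Instr.exec, Config.setIdx, hI5, hI.idx3]
    have hI' := hI.update b
    refine Leads.step (.jumpIdx 5 1 31) rfl hN (s' := ⟨31, Function.update I 5 b, N, E⟩) ?_ ?_
    · simp [Instr.exec, Config.jumpIf, hI.idx1]
    have htb : tailMass F c b e b = 1 := by simp [tailMass]
    have hlast : 1 - N (k + 7) ∈ G := by
      have := hG.sub b
      rwa [htb, ← hNt] at this
    -- The bottom cell takes what is missing to total mass `1`. If `b = 2` this destroys the
    -- constant in `N[2]`, which is no longer needed.
    refine Leads.step (.numSub 1 4 8) rfl hN (s' := ⟨32, Function.update I 5 b,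
      Function.update N b (1 - N (k + 7)), E⟩) ?_ (Leads.done (update_mem hN _ hlast) ?_)
    · simp [Instr.exec, Config.setNum, Config.getNum, hI.idx1, hI.idx4, hI.idx8, hN2]
    · refine ⟨le_rfl, hI'.idx0, hI'.idx1, fun i hbi hie => ⟨hE i hbi hie, ?_⟩⟩
      change Function.update N b (1 - N (k + 7)) i = _
      rcases hbi.eq_or_lt with rfl | h
      · rw [Function.update_self, htb, hNt]
      · rw [Function.update_of_ne h.ne', hNhigh i h hie]
  | succ j hbj ih =>
    have hbj' : b < j := hbj
    refine Leads.mono (T := 10 * (j - b) + 10) ?_ (by omega)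
    refine Leads.step (.idxSub 5 5 3) rfl hN (s' := ⟨22, Function.update I 5 j, N, E⟩) ?_ ?_
    · simp [Instr.exec, Config.setIdx, hI5, hI.idx3]
    have hI' := hI.update j
    refine Leads.step (.jumpIdx 5 1 31) rfl hN (s' := ⟨23, Function.update I 5 j, N, E⟩) ?_ ?_
    · simp [Instr.exec, Config.jumpIf, hI.idx1, hbj']
    have hsum : N (k + 5) + N j = ∑ l ∈ Finset.Ico j e, c l := by
      have hjlt : j < e := hje
      rw [hNu, hNlow j hbj' (Nat.lt_succ_self j), Finset.sum_eq_sum_Ico_succ_bot hjlt, add_comm]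
    have htj : tailMass F c b e j = F (∑ l ∈ Finset.Ico j e, c l) := by
      rw [tailMass, if_neg (by omega), if_pos (by omega)]
    have hsub : tailMass F c b e j - N (k + 7) ∈ G := by
      rw [hNt]
      exact hG.sub j
    refine leads_loopBody hI' (Function.update_self ..) (by omega) hN0 hN1 hN2 hsum
      (htj.trans (hF j)) hN hG.one (hG.sum j) (hG.sum_add j) (hG.div j) hsub ?_
    have htG : tailMass F c b e j ∈ G := by
      rw [htj, hF]
      rcases min_choice 1 ((∑ l ∈ Finset.Ico j e, c l + A) / D) with h2 | h2 <;> rw [h2]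
      exacts [hG.one, hG.div j]
    refine ih (by omega) hI' (Function.update_self ..) ?_ ?_ ?_ ?_ ?_ ?_ ?_ ?_
    · exact update_mem (update_mem (update_mem (update_mem hN _ (hG.sum j)) _ htG) _ hsub) _ htG
    · simp [hN0, show 0 ≠ j by omega]
    · simp [hN1, show 1 ≠ j by omega]
    · simp [hN2, show 2 ≠ j by omega]
    · simp [show k + 5 ≠ j by omega]
    · simp
    · intro i h1 h2
      rw [Function.update_of_ne (by omega), Function.update_of_ne (by omega),
        Function.update_of_ne (by omega), Function.update_of_ne (by omega)]
      exact hNlow i h1 (by omega)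
    · intro i h1 h2
      rw [Function.update_of_ne (by omega)]
      rcases h1.eq_or_lt with rfl | h1
      · rw [Function.update_self, hNt]
      · rw [Function.update_of_ne (by omega), Function.update_of_ne (by omega),
          Function.update_of_ne (by omega)]
        exact hNhigh i h1 h2

end Program

/-! ### Constants, and completion of the chain by `⊥` and `⊤` -/

section Prologue

variable {L : Type u} [Lattice L] [BoundedOrder L]
  {G : Set ℝ} {T : ℕ} {Q : Config L → Prop}

lemma leads_constants {k : ℕ} {C ε lam : ℝ} {I : ℕ → ℕ} {N : ℕ → ℝ} {E : ℕ → L}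
    (hI0 : I 0 = k) (hI : ∀ i, i ≠ 0 → I i = 0) (hN0 : N 0 = C) (hN1 : N 1 = ε)
    (hN2 : N 2 = lam) (hN : ∀ a, N a ∈ G) (h1 : 1 ∈ G) (hG1 : lam * C ∈ G)
    (hG2 : ε * lam ∈ G) (hG3 : ε * lam + ε * lam ∈ G) (hG4 : ε * lam + ε * lam + 1 ∈ G)
    (h : ∀ I', Registers k 3 (k + 3) I' → I' 5 = k + 3 → Leads resolventProgram G T Q
      ⟨12, I', Function.update (Function.update (Function.update N 0 (lam * C)) 1
        (ε * lam + ε * lam + 1)) 2 1, E⟩) :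
    Leads resolventProgram G (T + 12) Q ⟨0, I, N, E⟩ := by
  have hNa := update_mem hN 0 hG1
  have hNb := update_mem (update_mem hNa 1 hG3) 2 h1
  have hNc := update_mem (update_mem hNa 1 hG4) 2 h1
  set J := Function.update (Function.update I 3 1) 4 2 with hJ
  refine Leads.step (.idxConst 3 1) rfl hN (s' := ⟨1, Function.update I 3 1, N, E⟩) rfl ?_
  refine Leads.step (.idxConst 4 2) rfl hN (s' := ⟨2, J, N, E⟩) rfl ?_
  -- Index register `2` still has its initial value `0`, so it addresses `N[0]`.
  refine Leads.step (.numMul 2 4 2) rfl hN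
    (s' := ⟨3, J, Function.update N 0 (lam * C), E⟩) ?_ ?_
  · simp [Instr.exec, Config.setNum, Config.getNum, hJ, hI, hN0, hN2]
  refine Leads.step (.numMul 3 3 4) rfl hNa
    (s' := ⟨4, J, Function.update (Function.update N 0 (lam * C)) 1 (ε * lam), E⟩) ?_ ?_
  · simp [Instr.exec, Config.setNum, Config.getNum, hJ, hN1, hN2]
  refine Leads.step (.numAdd 3 3 3) rfl (update_mem hNa 1 hG2)
    (s' := ⟨5, J, Function.update (Function.update N 0 (lam * C)) 1 (ε * lam + ε * lam), E⟩) ?_ ?_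
  · simp [Instr.exec, Config.setNum, Config.getNum, hJ]
  refine Leads.step (.numOne 4) rfl (update_mem hNa 1 hG3)
    (s' := ⟨6, J, Function.update (Function.update (Function.update N 0 (lam * C)) 1
      (ε * lam + ε * lam)) 2 1, E⟩) ?_ ?_
  · simp [Instr.exec, Config.setNum, hJ]
  refine Leads.step (.numAdd 3 3 4) rfl hNb
    (s' := ⟨7, J, Function.update (Function.update (Function.update N 0 (lam * C)) 1
      (ε * lam + ε * lam + 1)) 2 1, E⟩) ?_ ?_
  · simp only [Instr.exec, Config.setNum, Config.getNum, hJ]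
    simp only [Config.mk.injEq, true_and, and_true]
    ext a
    simp only [Function.update_apply]
    norm_num
    split_ifs with h1 h2 <;> simp_all
  refine Leads.step (.idxConst 1 3) rfl hNc (s' := ⟨8, _, _, E⟩) rfl ?_
  refine Leads.step (.idxAdd 5 0 1) rfl hNc (s' := ⟨9, _, _, E⟩) rfl ?_
  refine Leads.step (.idxAdd 6 5 4) rfl hNc (s' := ⟨10, _, _, E⟩) rfl ?_
  refine Leads.step (.idxAdd 7 6 3) rfl hNc (s' := ⟨11, _, _, E⟩) rfl ?_
  refine Leads.step (.idxAdd 8 7 3) rfl hNc (s' := ⟨12, _, _, E⟩) rfl ?_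
  refine h _ ?_ ?_
  · constructor <;> simp [hJ, hI0, hI, add_assoc]
  · simp [hJ, hI0]

/-- `⊤` is written behind the chain in any case; only the end `e` depends on whether it was already
present. `leads_prependBot` treats `⊥` and `b` alike. -/
lemma leads_appendTop {k e : ℕ} {I : ℕ → ℕ} {N : ℕ → ℝ} {E : ℕ → L}
    (hI : Registers k 3 (k + 3) I) (hI5 : I 5 = k + 3) (hN : ∀ a, N a ∈ G)
    (he : ⊤ ≤ E (k + 2) ∧ e = k + 3 ∨ ¬ ⊤ ≤ E (k + 2) ∧ e = k + 4)
    (h : ∀ I', Registers k 3 e I' → I' 5 = e →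
      Leads resolventProgram G T Q ⟨17, I', N, Function.update E (k + 3) ⊤⟩) :
    Leads resolventProgram G (T + 5) Q ⟨12, I, N, E⟩ := by
  have hI0 : I 0 = k := by simpa using hI.idx0
  refine Leads.step (.eltTop 5) rfl hN (s' := ⟨13, I, N, Function.update E (k + 3) ⊤⟩) ?_ ?_
  · simp [Instr.exec, Config.setElt, hI5]
  refine Leads.step (.idxSub 9 5 3) rfl hN
    (s' := ⟨14, Function.update I 9 (k + 2), N, Function.update E (k + 3) ⊤⟩) ?_ ?_
  · simp [Instr.exec, Config.setIdx, hI5, hI.idx3]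
  rcases he with ⟨hle, rfl⟩ | ⟨hle, rfl⟩
  · refine Leads.step (.jumpElt 5 9 17) rfl hN
      (s' := ⟨17, Function.update I 9 (k + 2), N, Function.update E (k + 3) ⊤⟩) ?_
      ((h _ ?_ ?_).mono (by omega))
    · have : (⊤ : L) = E (k + 2) := (top_le_iff.1 hle).symm
      simp [Instr.exec, Config.jumpIf, Config.getElt, hI5, ← this]
    · constructor <;> simp [hI.idx0, hI.idx1, hI.idx2, hI.idx3, hI.idx4, hI.idx6, hI.idx7, hI.idx8]
    · simp [hI5]
  · refine Leads.step (.jumpElt 5 9 17) rfl hN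
      (s' := ⟨15, Function.update I 9 (k + 2), N, Function.update E (k + 3) ⊤⟩) ?_ ?_
    · rw [top_le_iff] at hle
      simp [Instr.exec, Config.jumpIf, Config.getElt, hI5, hle]
    refine Leads.step (.idxAdd 0 0 3) rfl hN (s' := ⟨16, _, _, _⟩) rfl ?_
    refine Leads.step (.idxAdd 5 5 3) rfl hN (s' := ⟨17, _, _, _⟩) rfl (h _ ?_ ?_)
    · constructor <;> simp [hI0, hI.idx1, hI.idx2, hI.idx3, hI.idx4, hI.idx6, hI.idx7, hI.idx8]
    · simp [hI5, hI.idx3]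

lemma leads_prependBot {k b e : ℕ} {I : ℕ → ℕ} {N : ℕ → ℝ} {E : ℕ → L} (he : 3 < e)
    (hI : Registers k 3 e I) (hI5 : I 5 = e) (hN : ∀ a, N a ∈ G)
    (hb : E 3 ≤ ⊥ ∧ b = 3 ∨ ¬ E 3 ≤ ⊥ ∧ b = 2)
    (h : ∀ I', Registers k b e I' → I' 5 = e →
      Leads resolventProgram G T Q ⟨21, I', N, Function.update E 2 ⊥⟩) :
    Leads resolventProgram G (T + 4) Q ⟨17, I, N, E⟩ := by
  refine Leads.step (.eltBot 4) rfl hN (s' := ⟨18, I, N, Function.update E 2 ⊥⟩) ?_ ?_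
  · simp [Instr.exec, Config.setElt, hI.idx4]
  rcases hb with ⟨hle, rfl⟩ | ⟨hle, rfl⟩
  · refine Leads.step (.jumpElt 1 4 21) rfl hN (s' := ⟨21, I, N, Function.update E 2 ⊥⟩) ?_
      ((h _ hI hI5).mono (by omega))
    rw [le_bot_iff] at hle
    simp [Instr.exec, Config.jumpIf, Config.getElt, hI.idx1, hI.idx4, hle]
  · refine Leads.step (.jumpElt 1 4 21) rfl hN (s' := ⟨19, I, N, Function.update E 2 ⊥⟩) ?_ ?_
    · rw [le_bot_iff] at hle
      simp [Instr.exec, Config.jumpIf, Config.getElt, hI.idx1, hI.idx4, hle]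
    refine Leads.step (.idxAdd 0 0 3) rfl hN (s' := ⟨20, _, _, _⟩) rfl ?_
    refine Leads.step (.idxConst 1 2) rfl hN (s' := ⟨21, _, _, _⟩) rfl (h _ ?_ ?_)
    · constructor <;> simp [hI.idx0, hI.idx2, hI.idx3, hI.idx4, hI.idx6, hI.idx7, hI.idx8]
      omega
    · simp [hI5]

/-- The given chain, stored from address `3` on, preceded by `⊥` and followed by `⊤`. -/
def eltCell {k : ℕ} (p : Fin k → L) (a : ℕ) : L :=
  if a < 3 then ⊥ else if h : a - 3 < k then p ⟨a - 3, h⟩ else ⊤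

/-- The given coefficients, stored from address `3` on. -/
def numCell {R : Type*} [Zero R] {k : ℕ} (c : Fin k → R) (a : ℕ) : R :=
  if a < 3 then 0 else if h : a - 3 < k then c ⟨a - 3, h⟩ else 0

/-- The set `G` contains all numbers that the program stores before the main loop. -/
structure StartClosed (G : Set ℝ) (C ε lam : ℝ) {k : ℕ} (c : Fin k → ℝ) : Prop where
  zero : 0 ∈ G
  one : 1 ∈ G
  param1 : C ∈ G
  param2 : ε ∈ G
  param3 : lam ∈ G
  coeff : ∀ i, c i ∈ G
  mul1 : lam * C ∈ G
  mul2 : ε * lam ∈ G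
  two_mul : ε * lam + ε * lam ∈ G
  denom : ε * lam + ε * lam + 1 ∈ G

lemma leads_initConfig {k b e : ℕ} {F : ℝ → ℝ} {C ε lam : ℝ} {p : Fin k → L} {c : Fin k → ℝ}
    (hk : 1 ≤ k) (hG : StartClosed G C ε lam c)
    (hG' : LoopClosed G F (lam * C) (ε * lam + ε * lam + 1) (numCell c) b e)
    (hF : ∀ i, F (∑ l ∈ Finset.Ico i e, numCell c l) =
      min 1 ((∑ l ∈ Finset.Ico i e, numCell c l + lam * C) / (ε * lam + ε * lam + 1)))
    (he : ⊤ ≤ eltCell p (k + 2) ∧ e = k + 3 ∨ ¬ ⊤ ≤ eltCell p (k + 2) ∧ e = k + 4)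
    (hb : eltCell p 3 ≤ ⊥ ∧ b = 3 ∨ ¬ eltCell p 3 ≤ ⊥ ∧ b = 2) :
    Leads resolventProgram G (10 * k + 41) (IsFinal F (numCell c) (eltCell p) b e)
      (initConfig C ε lam p c) := by
  have hk3 : 3 < e := by omega
  have hek : e ≤ k + 4 := by omega
  have hb2 : 2 ≤ b := by omega
  have hb3 : b ≤ 3 := by omega
  set s := initConfig C ε lam p c with hs
  have hnum : ∀ a, 3 ≤ a → s.num a = numCell c a := by
    intro a ha
    simp [hs, initConfig, numCell, show a ≠ 0 by omega, show a ≠ 1 by omega, show a ≠ 2 by omega,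
      show ¬ a < 3 by omega]
  have helt : ∀ a, 3 ≤ a → a < k + 3 → s.elt a = eltCell p a := by
    intro a ha ha'
    simp [hs, initConfig, eltCell, show ¬ a < 3 by omega, show a - 3 < k by omega]
  have hN0 : s.num 0 = C := by simp [hs, initConfig]
  have hN1 : s.num 1 = ε := by simp [hs, initConfig]
  have hN2 : s.num 2 = lam := by simp [hs, initConfig]
  have hN : ∀ a, s.num a ∈ G := by
    intro a
    simp only [hs, initConfig]
    split_ifs
    exacts [hG.param1, hG.param2, hG.param3, hG.coeff _, hG.zero]
  have hN' := update_mem (update_mem (update_mem hN 0 hG.mul1) 1 hG.denom) 2 hG.one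
  set N' := Function.update (Function.update (Function.update s.num 0 (lam * C)) 1
    (ε * lam + ε * lam + 1)) 2 1 with hN'def
  have hnum' : ∀ a, 3 ≤ a → N' a = numCell c a := by
    intro a ha
    rw [hN'def, Function.update_of_ne (by omega), Function.update_of_ne (by omega),
      Function.update_of_ne (by omega), hnum a ha]
  have hcell : ∀ a, k + 3 ≤ a → numCell c a = 0 := by
    intro a ha
    simp [numCell, show ¬ a < 3 by omega, show ¬ a - 3 < k by omega]
  -- The completed chain has at most `k + 2` cells, so this is at most `10 * k + 41`.
  refine Leads.mono (T := 10 * (e - b) + 4 + 5 + 12) ?_ (by omega)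
  change Leads _ _ _ _ ⟨0, s.idx, s.num, s.elt⟩
  refine leads_constants (k := k) (by simp [hs, initConfig])
    (fun i hi => by simp [hs, initConfig, hi])
    hN0 hN1 hN2 hN hG.one hG.mul1 hG.mul2 hG.two_mul hG.denom fun I1 hI1 hI15 => ?_
  refine leads_appendTop hI1 hI15 hN' (helt (k + 2) (by omega) (by omega) ▸ he)
    fun I2 hI2 hI25 => ?_
  refine leads_prependBot (b := b) hk3 hI2 hI25 hN' ?_ fun I3 hI3 hI35 => ?_
  · rwa [Function.update_of_ne (by omega), helt 3 le_rfl (by omega)]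
  refine leads_loop hb2 hek hG' hF ?_ e (by omega) le_rfl hI3 hI35 hN' ?_ ?_ ?_ ?_ ?_ ?_ ?_
  · intro i hbi hie
    rcases eq_or_ne i 2 with rfl | h2
    · simp [eltCell]
    rw [Function.update_of_ne h2]
    rcases eq_or_ne i (k + 3) with rfl | h3
    · simp [eltCell]
    · rw [Function.update_of_ne h3]
      exact helt i (by omega) (by omega)
  · simp
  · simp
  · simp
  -- The scratch cells lie beyond the input, so they start at `0`, as the empty tail requires.
  · rw [Finset.Ico_self, Finset.sum_empty]
    exact (hnum' _ (by omega)).trans (hcell _ (by omega))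
  · refine ((hnum' _ (by omega)).trans (hcell _ (by omega))).trans ?_
    rw [tailMass, if_neg (by omega),
      if_neg (lt_irrefl e)]
  · exact fun i h1 h2 => hnum' i (by omega)
  · exact fun i h1 h2 => absurd h1 (by omega)

end Prologue

/-! ### Memory cells as points of the complex -/

section Cells

variable {L : Type u} [Lattice L]

lemma Represents.coeff_eq {k : ℕ} {p : Fin k → L} {c : Fin k → ℝ} {x : K L}
    (h : Represents p c x) (i : Fin k) : x.coeff (p i) = c i := by
  classical
  rw [K.coeff, h.2, Finsupp.finsetSum_apply, Finset.sum_eq_single i]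
  · simp
  · exact fun j _ hj => Finsupp.single_eq_of_ne (h.1.injective.ne hj.symm)
  · simp

lemma Represents.pos {k : ℕ} {p : Fin k → L} {c : Fin k → ℝ} {x : K L}
    (h : Represents p c x) : 1 ≤ k := by
  rcases Nat.eq_zero_or_pos k with rfl | hk
  · have h1 := x.2.2.1
    rw [h.2] at h1
    simp at h1
  · exact hk

variable [BoundedOrder L]

lemma numCell_add_three {R : Type*} [Zero R] {k : ℕ} (c : Fin k → R) (i : Fin k) :
    numCell c (3 + i) = c i := by
  simp [numCell]

lemma numCell_eq_zero {R : Type*} [Zero R] {k : ℕ} (c : Fin k → R) {a : ℕ}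
    (ha : a < 3 ∨ k + 3 ≤ a) : numCell c a = 0 := by
  unfold numCell
  split_ifs
  · rfl
  · omega
  · rfl

lemma numCell_of_forall {R : Type*} [Zero R] {k : ℕ} {c : Fin k → R} {P : ℕ → R → Prop}
    (h0 : ∀ a, a < 3 ∨ k + 3 ≤ a → P a 0) (h : ∀ i : Fin k, P (3 + i) (c i)) (a : ℕ) :
    P a (numCell c a) := by
  by_cases ha : a < 3 ∨ k + 3 ≤ a
  · rw [numCell_eq_zero c ha]
    exact h0 a ha
  · obtain ⟨i, rfl⟩ : ∃ i : Fin k, a = 3 + i := ⟨⟨a - 3, by omega⟩, by simp; omega⟩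
    rw [numCell_add_three]
    exact h i

lemma sum_Ico_three {M : Type*} [AddCommMonoid M] {k : ℕ} {f : ℕ → M} {g : Fin k → M}
    (h : ∀ i : Fin k, f (3 + i) = g i) : ∑ a ∈ Finset.Ico 3 (k + 3), f a = ∑ i, g i := by
  rw [Finset.sum_Ico_eq_sum_range, Nat.add_sub_cancel, Finset.sum_range]
  exact Finset.sum_congr rfl fun i _ => h i

lemma eltCell_add_three {k : ℕ} (p : Fin k → L) (i : Fin k) : eltCell p (3 + i) = p i := by
  simp [eltCell]

lemma eltCell_monotone {k : ℕ} {p : Fin k → L} (hp : Monotone p) : Monotone (eltCell p) := by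
  intro a b hab
  unfold eltCell
  split_ifs <;> first | exact bot_le | exact le_top | (exfalso; omega) | skip
  exact hp (Fin.mk_le_mk.2 (by omega))

/-- Repetitions can occur only where the added `⊥` or `⊤` meets an end of the given chain, and the
choice of `b` and `e` excludes them. -/
lemma eltCell_strictMonoOn {k b e : ℕ} {p : Fin k → L} (hp : StrictMono p)
    (he : ⊤ ≤ eltCell p (k + 2) ∧ e = k + 3 ∨ ¬ ⊤ ≤ eltCell p (k + 2) ∧ e = k + 4)
    (hb : eltCell p 3 ≤ ⊥ ∧ b = 3 ∨ ¬ eltCell p 3 ≤ ⊥ ∧ b = 2) :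
    StrictMonoOn (eltCell p) (Set.Ico b e) := by
  rintro i ⟨hbi, hie⟩ j ⟨hbj, hje⟩ hij
  have hmono := eltCell_monotone hp.monotone
  refine lt_of_le_of_ne (hmono hij.le) fun h => ?_
  by_cases hi : i < 3
  · have h2 : ¬ eltCell p 3 ≤ ⊥ := by
      rcases hb with h | h
      · omega
      · exact h.1
    refine h2 ((hmono (by omega : 3 ≤ j)).trans (h ▸ ?_))
    simp [eltCell, hi]
  · by_cases hj : k + 3 ≤ j
    · have h2 : ¬ ⊤ ≤ eltCell p (k + 2) := by
        rcases he with h | h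
        · omega
        · exact h.1
      refine h2 (le_trans ?_ (hmono (by omega : i ≤ k + 2)))
      rw [h]
      simp [eltCell, show ¬ j < 3 by omega, show ¬ j - 3 < k by omega]
    · refine (hp (show (⟨i - 3, by omega⟩ : Fin k) < ⟨j - 3, by omega⟩ from ?_)).ne ?_
      · rw [Fin.mk_lt_mk]
        omega
      · simpa [eltCell, hi, show ¬ j < 3 by omega, show i - 3 < k by omega,
          show j - 3 < k by omega] using h

lemma sum_cells_eq {k b e : ℕ} (p : Fin k → L) (c : Fin k → ℝ) (hb : b ≤ 3) (he : k + 3 ≤ e) :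
    ∑ a ∈ Finset.Ico b e, Finsupp.single (eltCell p a) (numCell c a) =
      ∑ i, Finsupp.single (p i) (c i) := by
  rw [← sum_Ico_three (f := fun a => Finsupp.single (eltCell p a) (numCell c a))
    fun i => by rw [eltCell_add_three, numCell_add_three]]
  refine (Finset.sum_subset (Finset.Ico_subset_Ico hb he) fun a _ ha => ?_).symm
  rw [Finset.mem_Ico] at ha
  rw [numCell_eq_zero c (by omega), Finsupp.single_zero]

/-- For nonnegative data the truncation at `0` is vacuous, so the program compares only with `1`. -/
lemma clip_eq_min {C ε lam r : ℝ} (hC : 0 ≤ C) (hε : 0 ≤ ε) (hlam : 0 < lam) (hr : 0 ≤ r) :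
    clip C ε lam r = min 1 ((r + lam * C) / (ε * lam + ε * lam + 1)) := by
  have : 1 + 2 * ε * lam = ε * lam + ε * lam + 1 := by ring
  rw [clip, this]
  exact max_eq_right (le_min zero_le_one (by positivity))

/-- The final cells spell out the point of `exists_isClip_of_chain`; uniqueness of clips identifies
it with `y`. -/
lemma IsFinal.outputs {T : ℝ → ℝ} (hT : Monotone T) (hT0 : ∀ r, 0 ≤ T r) (hT1 : ∀ r, T r ≤ 1)
    {k b e : ℕ} {p : Fin k → L} {c : Fin k → ℝ} {x y : K L} (hx : Represents p c x)
    (hy : IsClip T x y)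
    (he : ⊤ ≤ eltCell p (k + 2) ∧ e = k + 3 ∨ ¬ ⊤ ≤ eltCell p (k + 2) ∧ e = k + 4)
    (hb : eltCell p 3 ≤ ⊥ ∧ b = 3 ∨ ¬ eltCell p 3 ≤ ⊥ ∧ b = 2) {s : Config L}
    (hs : IsFinal T (numCell c) (eltCell p) b e s) : s.Outputs y := by
  have hk := hx.pos
  have hbot : eltCell p b = ⊥ := by
    rcases hb with ⟨h, rfl⟩ | ⟨-, rfl⟩
    · exact le_bot_iff.1 h
    · simp [eltCell]
  have htop : eltCell p (e - 1) = ⊤ := by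
    rcases he with ⟨h, rfl⟩ | ⟨-, rfl⟩
    · exact top_le_iff.1 h
    · simp [eltCell]
  have hmono := eltCell_strictMonoOn hx.1 he hb
  obtain ⟨z, hz, hzc⟩ := exists_isClip_of_chain hT hT0 hT1 (x := x) (by omega : b < e) hmono hbot
    htop (hx.2.trans (sum_cells_eq p c (by omega) (by omega)).symm)
  obtain rfl := hy.unique hzc
  obtain ⟨-, h0, h1, h2⟩ := hs
  unfold Config.Outputs
  rw [h0, h1]
  refine ⟨fun i j hij => ?_, ?_⟩
  · change s.elt _ < s.elt _
    rw [(h2 _ (by omega) (by omega)).1, (h2 _ (by omega) (by omega)).1]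
    refine hmono ⟨by omega, by omega⟩ ⟨by omega, by omega⟩ ?_
    exact Nat.add_lt_add_left hij b
  · rw [hz, Finset.sum_Ico_eq_sum_range, Finset.sum_range]
    refine Finset.sum_congr rfl fun i _ => ?_
    obtain ⟨h3, h4⟩ := h2 (b + i) (by omega) (by omega)
    simp only [h3, h4]

end Cells

/-! ### Heights of rational numbers -/

section Height

/-- The sum of the absolute values of numerator and denominator. -/
def height (r : ℚ) : ℕ := r.num.natAbs + r.den

lemma height_divInt_le (m : ℤ) {n : ℕ} (hn : 0 < n) : height (Rat.divInt m n) ≤ m.natAbs + n := by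
  refine Nat.add_le_add ?_ (Nat.le_of_dvd hn (by exact_mod_cast Rat.den_dvd m n))
  rcases eq_or_ne m 0 with rfl | hm
  · simp
  · exact Nat.le_of_dvd (Int.natAbs_pos.2 hm)
      (Int.natAbs_dvd_natAbs.2 (Rat.num_dvd m (by exact_mod_cast hn.ne')))

/-- The unreduced numerator and denominator of the sum are bounded by terms of the expanded product,
and reduction only helps. Submultiplicativity lets the exponents of heights add up under all four
operations. -/
lemma height_add_le (a b : ℚ) : height (a + b) ≤ height a * height b := by
  have h : a + b = Rat.divInt (a.num * b.den + b.num * a.den) (a.den * b.den : ℕ) := by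
    push_cast
    exact Rat.add_def' a b
  rw [h]
  refine (height_divInt_le _ (Nat.mul_pos a.den_pos b.den_pos)).trans ?_
  have h1 := Int.natAbs_add_le (a.num * b.den) (b.num * a.den)
  rw [Int.natAbs_mul, Int.natAbs_mul, Int.natAbs_natCast, Int.natAbs_natCast] at h1
  unfold height
  nlinarith [Nat.zero_le (a.num.natAbs * b.num.natAbs)]

lemma height_neg (a : ℚ) : height (-a) = height a := by
  simp [height]

lemma height_mul_le (a b : ℚ) : height (a * b) ≤ height a * height b := by
  have h : a * b = Rat.divInt (a.num * b.num) (a.den * b.den : ℕ) := by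
    push_cast
    exact Rat.mul_eq_mkRat a b
  rw [h]
  refine (height_divInt_le _ (Nat.mul_pos a.den_pos b.den_pos)).trans ?_
  rw [Int.natAbs_mul]
  unfold height
  nlinarith [Nat.zero_le (a.num.natAbs * b.den), Nat.zero_le (a.den * b.num.natAbs)]

lemma height_inv_le (a : ℚ) : height a⁻¹ ≤ height a := by
  rcases eq_or_ne a 0 with rfl | ha
  · simp
  · have h1 : a.num ≠ 0 := by simpa using ha
    rw [height, height, Rat.num_inv, Rat.den_inv, Int.natAbs_mul, Int.natAbs_natCast,
      Int.natAbs_sign_of_ne_zero h1, if_neg h1]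
    omega

lemma height_le_two_pow (r : ℚ) : height r ≤ 2 ^ ratSize r := by
  have h := Nat.mul_le_mul (Nat.succ_le_of_lt (Nat.lt_size_self r.num.natAbs))
    (Nat.succ_le_of_lt (Nat.lt_size_self r.den))
  rw [ratSize, pow_add, height]
  nlinarith [Nat.zero_le (r.num.natAbs * r.den)]

lemma ratSize_le_of_height_le {r : ℚ} {m : ℕ} (h : height r ≤ 2 ^ m) : ratSize r ≤ 2 * m + 1 := by
  have h0 := r.den_pos
  unfold height at h
  -- The denominator is at least `1`, so the numerator is strictly below `2 ^ m`.
  have h1 : Nat.size r.num.natAbs ≤ m := Nat.size_le.2 (by omega)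
  have h2 : Nat.size r.den ≤ m + 1 := Nat.size_le.2 (by rw [pow_succ]; omega)
  unfold ratSize
  omega

/-- The real numbers that are rational of height at most `N`. -/
def heightLE (N : ℕ) : Set ℝ := {v | ∃ r : ℚ, (r : ℝ) = v ∧ height r ≤ N}

variable {M N : ℕ} {v w : ℝ}

lemma heightLE_mono (h : M ≤ N) (hv : v ∈ heightLE M) : v ∈ heightLE N :=
  let ⟨r, hr, hr'⟩ := hv
  ⟨r, hr, hr'.trans h⟩

lemma zero_mem_heightLE (h : 1 ≤ N) : (0 : ℝ) ∈ heightLE N := ⟨0, by simp, h⟩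

lemma one_mem_heightLE (h : 2 ≤ N) : (1 : ℝ) ∈ heightLE N := ⟨1, by simp, h⟩

lemma cast_mem_heightLE (r : ℚ) : (r : ℝ) ∈ heightLE (2 ^ ratSize r) :=
  ⟨r, rfl, height_le_two_pow r⟩

lemma add_mem_heightLE (hv : v ∈ heightLE M) (hw : w ∈ heightLE N) :
    v + w ∈ heightLE (M * N) := by
  obtain ⟨r, rfl, hr⟩ := hv
  obtain ⟨s, rfl, hs⟩ := hw
  exact ⟨r + s, by simp, (height_add_le r s).trans (Nat.mul_le_mul hr hs)⟩

lemma sub_mem_heightLE (hv : v ∈ heightLE M) (hw : w ∈ heightLE N) :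
    v - w ∈ heightLE (M * N) := by
  rw [sub_eq_add_neg]
  obtain ⟨s, rfl, hs⟩ := hw
  exact add_mem_heightLE hv ⟨-s, by simp, (height_neg s).trans_le hs⟩

lemma mul_mem_heightLE (hv : v ∈ heightLE M) (hw : w ∈ heightLE N) :
    v * w ∈ heightLE (M * N) := by
  obtain ⟨r, rfl, hr⟩ := hv
  obtain ⟨s, rfl, hs⟩ := hw
  exact ⟨r * s, by simp, (height_mul_le r s).trans (Nat.mul_le_mul hr hs)⟩

lemma div_mem_heightLE (hv : v ∈ heightLE M) (hw : w ∈ heightLE N) :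
    v / w ∈ heightLE (M * N) := by
  rw [div_eq_mul_inv]
  obtain ⟨s, rfl, hs⟩ := hw
  exact mul_mem_heightLE hv ⟨s⁻¹, by simp, (height_inv_le s).trans hs⟩

lemma sum_mem_heightLE {ι : Type*} (s : Finset ι) {f : ι → ℝ} {g : ι → ℕ}
    (h : ∀ i ∈ s, f i ∈ heightLE (2 ^ g i)) : ∑ i ∈ s, f i ∈ heightLE (2 ^ ∑ i ∈ s, g i) := by
  classical
  induction s using Finset.induction_on with
  | empty => exact zero_mem_heightLE (by simp)
  | insert i s hi ih =>
    rw [Finset.sum_insert hi, Finset.sum_insert hi, pow_add]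
    exact add_mem_heightLE (h i (Finset.mem_insert_self i s))
      (ih fun j hj => h j (Finset.mem_insert_of_mem hj))

end Height

/-! ### Bit lengths during the computation -/

section Bounds

lemma sum_numCell_mem_heightLE {k : ℕ} (c : Fin k → ℚ) (i e : ℕ) :
    ∑ l ∈ Finset.Ico i e, numCell (fun j => (c j : ℝ)) l ∈ heightLE (2 ^ ∑ j, ratSize (c j)) := by
  have h := sum_mem_heightLE (Finset.Ico i e) (f := numCell fun j => (c j : ℝ))
    (g := numCell fun j => ratSize (c j)) fun a _ =>
      numCell_of_forall (P := fun a r => r ∈ heightLE (2 ^ numCell (fun j => ratSize (c j)) a))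
        (fun a ha => zero_mem_heightLE Nat.one_le_two_pow)
        (fun j => by
          rw [numCell_add_three]
          exact cast_mem_heightLE (c j)) a
  refine heightLE_mono (Nat.pow_le_pow_right two_pos ?_) h
  rw [← sum_Ico_three (numCell_add_three fun j => ratSize (c j))]
  refine Finset.sum_le_sum_of_ne_zero fun a _ ha => ?_
  by_contra hn
  rw [Finset.mem_Ico] at hn
  exact ha (numCell_eq_zero _ (by omega))

lemma cast_mem_heightLE_of_ratSize_le {r : ℚ} {S : ℕ} (h : ratSize r ≤ S) : (r : ℝ) ∈ heightLE (2 ^ S) :=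
  heightLE_mono (Nat.pow_le_pow_right two_pos h) (cast_mem_heightLE r)

/-- Exponents: `S` for a tail sum, `2S` for `lam * C`, `4S + 1` for the denominator, hence `7S + 1`
for a clipped tail and `14S + 2` for a difference of two. None depends on the number of passes. -/
lemma closed_heightLE {k : ℕ} (C ε lam : ℚ) (c : Fin k → ℚ) {S : ℕ} (hC : ratSize C ≤ S) (hε : ratSize ε ≤ S) (hlam : ratSize lam ≤ S)
    (hc : ∑ i, ratSize (c i) ≤ S) {F : ℝ → ℝ} {b e : ℕ}
    (hF : ∀ i, F (∑ l ∈ Finset.Ico i e, numCell (fun j => (c j : ℝ)) l) =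
      min 1 ((∑ l ∈ Finset.Ico i e, numCell (fun j => (c j : ℝ)) l + lam * C) /
        (ε * lam + ε * lam + 1))) :
    StartClosed (heightLE (2 ^ (14 * S + 2))) C ε lam (fun j => (c j : ℝ)) ∧
    LoopClosed (heightLE (2 ^ (14 * S + 2))) F (lam * C) (ε * lam + ε * lam + 1)
      (numCell fun j => (c j : ℝ)) b e := by
  have mono : ∀ {m : ℕ} {v : ℝ}, m ≤ 14 * S + 2 → v ∈ heightLE (2 ^ m) →
      v ∈ heightLE (2 ^ (14 * S + 2)) := fun h => heightLE_mono (Nat.pow_le_pow_right two_pos h)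
  have e1 : (C : ℝ) ∈ heightLE (2 ^ S) := cast_mem_heightLE_of_ratSize_le hC
  have e2 : (ε : ℝ) ∈ heightLE (2 ^ S) := cast_mem_heightLE_of_ratSize_le hε
  have e3 : (lam : ℝ) ∈ heightLE (2 ^ S) := cast_mem_heightLE_of_ratSize_le hlam
  have e4 : (lam * C : ℝ) ∈ heightLE (2 ^ (S + S)) := by
    rw [pow_add]
    exact mul_mem_heightLE e3 e1
  have e5 : (ε * lam : ℝ) ∈ heightLE (2 ^ (S + S)) := by
    rw [pow_add]
    exact mul_mem_heightLE e2 e3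
  have e6 : (ε * lam + ε * lam : ℝ) ∈ heightLE (2 ^ (S + S + (S + S))) := by
    rw [pow_add]
    exact add_mem_heightLE e5 e5
  have e7 : (ε * lam + ε * lam + 1 : ℝ) ∈ heightLE (2 ^ (S + S + (S + S) + 1)) := by
    rw [pow_succ]
    exact add_mem_heightLE e6 (one_mem_heightLE le_rfl)
  have e8 : ∀ i, ∑ l ∈ Finset.Ico i e, numCell (fun j => (c j : ℝ)) l ∈ heightLE (2 ^ S) :=
    fun i => heightLE_mono (Nat.pow_le_pow_right two_pos hc) (sum_numCell_mem_heightLE c i e)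
  have e9 : ∀ i, ∑ l ∈ Finset.Ico i e, numCell (fun j => (c j : ℝ)) l + lam * C ∈
      heightLE (2 ^ (S + (S + S))) := fun i => by
    rw [pow_add]
    exact add_mem_heightLE (e8 i) e4
  have e10 : ∀ i, (∑ l ∈ Finset.Ico i e, numCell (fun j => (c j : ℝ)) l + lam * C) /
      (ε * lam + ε * lam + 1) ∈ heightLE (2 ^ (7 * S + 1)) := fun i => by
    rw [show 7 * S + 1 = S + (S + S) + (S + S + (S + S) + 1) by ring, pow_add]
    exact div_mem_heightLE (e9 i) e7
  have h2 : 2 ≤ 2 ^ (7 * S + 1) := Nat.le_self_pow (by omega) 2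
  have e11 : ∀ i, tailMass F (numCell fun j => (c j : ℝ)) b e i ∈ heightLE (2 ^ (7 * S + 1)) := by
    intro i
    rw [tailMass, hF]
    split_ifs
    · exact one_mem_heightLE h2
    · rcases min_choice 1 ((∑ l ∈ Finset.Ico i e, numCell (fun j => (c j : ℝ)) l + lam * C) /
        (ε * lam + ε * lam + 1 : ℝ)) with h | h <;> rw [h]
      exacts [one_mem_heightLE h2, e10 i]
    · exact zero_mem_heightLE (by omega)
  have one : (1 : ℝ) ∈ heightLE (2 ^ (14 * S + 2)) := one_mem_heightLE (Nat.le_self_pow (by omega) 2)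
  constructor
  · exact
      { zero := zero_mem_heightLE Nat.one_le_two_pow
        one := one
        param1 := mono (by omega) e1
        param2 := mono (by omega) e2
        param3 := mono (by omega) e3
        coeff := fun i => mono (by omega) (cast_mem_heightLE_of_ratSize_le
          ((Finset.single_le_sum (f := fun i => ratSize (c i)) (fun _ _ => Nat.zero_le _)
            (Finset.mem_univ i)).trans hc))
        mul1 := mono (by omega) e4
        mul2 := mono (by omega) e5
        two_mul := mono (by omega) e6
        denom := mono (by omega) e7 }
  · exact
      { one := one
        sum := fun i => mono (by omega) (e8 i)
        sum_add := fun i => mono (by omega) (e9 i)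
        div := fun i => mono (by omega) (e10 i)
        sub := fun i => by
          rw [show 14 * S + 2 = 7 * S + 1 + (7 * S + 1) by ring, pow_add]
          exact sub_mem_heightLE (e11 i) (e11 (i + 1)) }

end Bounds

end Ortho

/-! ### The main theorem -/

open Ortho

theorem mainTheorem6 :
    ∃ (P : Ortho.Program) (time bits : Polynomial ℕ),
      ∀ (L : Type u) [Lattice L] [BoundedOrder L] [IsModularLattice L] [ComplementedLattice L]
        (n : ℕ), Order.height (⊤ : L) = (n : ℕ∞) →
      ∀ C ε lam : ℝ, 0 ≤ C → 0 ≤ ε → 0 < lam →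
      ∃ J : Ortho.K L → Ortho.K L,
        -- `J` is the resolvent
        Ortho.IsResolvent (Ortho.objective C ε) lam J ∧
        ∀ x : Ortho.K L,
          -- every maximal simplex containing `x` contains `J x`, and lies in a frame
          (∀ s : Set L, IsMaxChain (· ≤ ·) s → x.supp ⊆ s →
            (J x).supp ⊆ s ∧ ∃ a : Fin n → L, Ortho.IsBase a ∧ s ⊆ Ortho.frame a) ∧
          -- in every frame whose subcomplex contains `x`, the minimizer is found coordinate-wise
          (∀ a : Fin n → L, Ortho.IsBase a → x.supp ⊆ Ortho.frame a →
            (J x).supp ⊆ Ortho.frame a ∧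
            ∀ i, Ortho.frameCoord a (J x) i =
              max 0 (min 1 ((Ortho.frameCoord a x i + lam * C) / (1 + 2 * ε * lam)))) ∧
          -- the program `P` computes `J x` in polynomial time
          (∀ (k : ℕ) (p : Fin k → L) (c : Fin k → ℝ), Ortho.Represents p c x →
            (∃ t ≤ time.eval k,
              P.Halted (P.run t (Ortho.initConfig C ε lam p c)) ∧
              (P.run t (Ortho.initConfig C ε lam p c)).Outputs (J x)) ∧
            -- on rational data, the bit lengths of all numbers stay polynomially bounded
            (∀ (C' ε' lam' : ℚ) (c' : Fin k → ℚ),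
              (C' : ℝ) = C → (ε' : ℝ) = ε → (lam' : ℝ) = lam → (∀ i, (c' i : ℝ) = c i) →
              ∀ t addr : ℕ, ∃ r : ℚ,
                (r : ℝ) = (P.run t (Ortho.initConfig C ε lam p c)).num addr ∧
                Ortho.ratSize r ≤ bits.eval (Ortho.ratSize C' + Ortho.ratSize ε' +
                  Ortho.ratSize lam' + ∑ i, Ortho.ratSize (c' i)))) := by
  -- The second polynomial is `2 * (14 * S + 2) + 1`, from `closed_heightLE` and
  -- `ratSize_le_of_height_le`.
  refine ⟨resolventProgram, 10 * Polynomial.X + 41, 28 * Polynomial.X + 5, ?_⟩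
  intro L _ _ _ _ n hn C ε lam hC hε hlam
  have hT := clip_monotone (C := C) hε hlam
  have hT0 := clip_nonneg C ε lam
  have hT1 := clip_le_one C ε lam
  have hex : ∀ x : K L, ∃ y, IsClip (clip C ε lam) x y := fun x =>
    let ⟨_, hp, hx⟩ := exists_isMaxChainSeq_supp_subset hn x
    exists_isClip_of_isMaxChainSeq hT hT0 hT1 hp hx
  choose J hJ using hex
  refine ⟨J, fun x => proxSet_objective_eq hn hε hlam (hJ x), fun x => ⟨fun s hs hx => ⟨?_, ?_⟩,
    fun a ha hx => (hJ x).frameCoord_eq hn ha hx, fun k p c hx => ?_⟩⟩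
  · exact (hJ x).supp_subset.trans
      (Set.insert_subset hs.bot_mem (Set.insert_subset hs.top_mem hx))
  · obtain ⟨q, hq, rfl⟩ := exists_isMaxChainSeq hn hs
    exact exists_isBase_range_subset_frame hq
  · obtain ⟨e, he⟩ : ∃ e, ⊤ ≤ eltCell p (k + 2) ∧ e = k + 3 ∨
        ¬ ⊤ ≤ eltCell p (k + 2) ∧ e = k + 4 := by
      by_cases h : ⊤ ≤ eltCell p (k + 2) <;> simp [h]
    obtain ⟨b, hb⟩ : ∃ b, eltCell p 3 ≤ ⊥ ∧ b = 3 ∨ ¬ eltCell p 3 ≤ ⊥ ∧ b = 2 := by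
      by_cases h : eltCell p 3 ≤ ⊥ <;> simp [h]
    have hc0 : ∀ a, 0 ≤ numCell c a := numCell_of_forall (P := fun _ r => 0 ≤ r)
      (fun _ _ => le_rfl) fun i => hx.coeff_eq i ▸ x.coeff_nonneg _
    have hF : ∀ i, clip C ε lam (∑ l ∈ Finset.Ico i e, numCell c l) =
        min 1 ((∑ l ∈ Finset.Ico i e, numCell c l + lam * C) / (ε * lam + ε * lam + 1)) :=
      fun i => clip_eq_min hC hε hlam (Finset.sum_nonneg fun a _ => hc0 a)
    constructor
    -- For real data no restriction is put on the stored numbers, so the closure conditions are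
    -- trivial.
    · obtain ⟨t, ht, hQ, -⟩ := leads_initConfig (G := Set.univ) (p := p) (c := c) hx.pos
        (by constructor <;> simp) (by constructor <;> simp) hF he hb
      exact ⟨t, by simpa using ht, hQ.1, hQ.outputs hT hT0 hT1 hx (hJ x) he hb⟩
    · rintro C' ε' lam' c' rfl rfl rfl hc' t addr
      obtain rfl : (fun i => (c' i : ℝ)) = c := funext hc'
      obtain ⟨h1, h2⟩ := closed_heightLE C' ε' lam' c' (b := b) (e := e)
        (S := ratSize C' + ratSize ε' + ratSize lam' + ∑ i, ratSize (c' i))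
        (by omega) (by omega) (by omega) (by omega) hF
      obtain ⟨r, hr, hr'⟩ := (leads_initConfig (p := p) hx.pos h1 h2 hF he hb).num_mem
        (fun s hs => hs.1) t addr
      refine ⟨r, hr, (ratSize_le_of_height_le hr').trans ?_⟩
      simp
      omega
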